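/- Let $X$ be a Banach space, $Y$ a separable Hilbert space, $-\infty<a<b<\infty$, $\tfrac12<\alpha\le 1$, $0\le\beta\le 1$ and $\gamma=\alpha+\beta(1-\alpha)$. Let $\psi\in C^1([a,b],\mathbb R)$ be increasing with $\psi'(t)\ne 0$ for all $t\in[a,b]$, and write $\Psi(t,s)=\psi(t)-\psi(s)$. Let $A$ be the infinitesimal generator of a strongly continuous semigroup $\{T(t)\}_{t\ge 0}$ of bounded linear operators on $X$, let $B:Y\to X$ be a bounded linear operator, and let $x_0,x_b\in X$ and $\lambda>0$. For $0<\alpha<1$ let $M_\alpha(\theta)=\sum_{n=0}^{\infty}\frac{(-\theta)^n}{n!\,\Gamma(1-\alpha(n+1))}$ be the Wright function (with $1/\Gamma=0$ at the poles of $\Gamma$) and put $$P_\alpha(t)x=\int_0^\infty \alpha\theta M_\alpha(\theta)\,T(t^\alpha\theta)x\,d\theta ,$$ while $P_1(t)=T(t)$. Let $K_\alpha(t)=t^{\alpha-1}P_\alpha(t)$ and, for $t\in(a,b]$, $$S_{\alpha,\beta}(\Psi(t,a))x=\bigl(I^{\gamma-\alpha;\psi}_{a+}K_\alpha(\Psi(\cdot,a))x\bigr)(t),\qquad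 (I^{\mu;\psi}_{a+}f)(t)=\frac1{\Gamma(\mu)}\int_a^t\psi'(s)\Psi(t,s)^{\mu-1}f(s)\,ds\ \ (\mu>0),$$ with $I^{0;\psi}_{a+}f=f$. Let $C^{1-\gamma;\psi}([a,b],X)$ be the space of all continuous $q:(a,b]\to X$ for which $\Psi(t,a)^{1-\gamma}q(t)$ extends to a continuous function on $[a,b]$. A mild solution of the linear $\psi$-Hilfer control system $${}^{H}D^{\alpha,\beta;\psi}_{a+}q(t)=Aq(t)+Bu(t),\quad t\in[a,b],\qquad (I^{1-\gamma;\psi}_{a+}q)(a)=x_0,$$ with control $u\in L^2([a,b],Y)$ is a function $q\in C^{1-\gamma;\psi}([a,b],X)$ such that $$q(t)=S_{\alpha,\beta}(\Psi(t,a))x_0+\int_a^t\psi'(s)K_\alpha(\Psi(t,s))Bu(s)\,ds,\qquad t\in(a,b].$$ Let $A_{ad}$ be the set of all pairs $(q,u)\in C^{1-\gamma;\psi}([a,b],X)\times L^2([a,b],Y)$ such that $q$ is the mild solution with control $u$, and let $$J(q,u)=\|q(b)-x_b\|_X^2+\lambda\int_a^b\|u(t)\|_Y^2\,dt .$$ **Theorem.**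 There exists a unique optimal pair, that is, a unique pair $(q^0,u^0)\in A_{ad}$ with $J(q^0,u^0)\le J(q,u)$ for all $(q,u)\in A_{ad}$ (controls being identified when equal almost everywhere). -/

import Mathlib

open Set Filter Topology MeasureTheory

noncomputable section

namespace PsiHilfer

/-- `T : [0, ∞) → L(X)` is a strongly continuous semigroup of bounded linear operators.
Only the values `T t` with `0 ≤ t` matter. -/
structure IsC0Semigroup {X : Type*} [NormedAddCommGroup X] [NormedSpace ℝ X]
    (T : ℝ → X →L[ℝ] X) : Prop where
  map_zero : T 0 = ContinuousLinearMap.id ℝ X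
  map_add : ∀ s t : ℝ, 0 ≤ s → 0 ≤ t → T (s + t) = (T s).comp (T t)
  strong_cont : ∀ x : X, Tendsto (fun t => T t x) (𝓝[>] 0) (𝓝 x)

/-- The (in general unbounded) operator `A` is the infinitesimal generator of `T`:
`x ∈ D(A)` and `A x = y` if and only if `h⁻¹ (T(h) x - x) → y` as `h → 0+`. -/
def IsGenerator {X : Type*} [NormedAddCommGroup X] [NormedSpace ℝ X]
    (A : X →ₗ.[ℝ] X) (T : ℝ → X →L[ℝ] X) : Prop :=
  ∀ x y : X, (x, y) ∈ A.graph ↔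
    Tendsto (fun h : ℝ => h⁻¹ • (T h x - x)) (𝓝[>] 0) (𝓝 y)

/-- The Wright function `M_α(θ) = ∑_{n ≥ 0} (-θ)^n / (n! Γ(1 - α (n + 1)))`, for `0 < α < 1`.
At the poles of `Γ` the factor `1 / Γ` is `0`, as it should be. -/
def wrightM (α θ : ℝ) : ℝ :=
  ∑' n : ℕ, (-θ) ^ n / ((n.factorial : ℝ) * Real.Gamma (1 - α * ((n : ℝ) + 1)))

/-- The derivative `ψ'` of a function `ψ` on the interval `[a, b]` (one-sided at the ends). -/
def dpsi (a b : ℝ) (ψ : ℝ → ℝ) (s : ℝ) : ℝ := derivWithin ψ (Icc a b) s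

/-- The left fractional integral of order `μ ≥ 0` with respect to `ψ`,
`(I^{μ;ψ}_{a+} f)(t) = (1 / Γ(μ)) ∫_a^t ψ'(s) (ψ(t) - ψ(s))^{μ-1} f(s) ds` for `μ > 0`,
and the identity for `μ = 0`. -/
def fracIntegral {X : Type*} [NormedAddCommGroup X] [NormedSpace ℝ X]
    (a b : ℝ) (ψ : ℝ → ℝ) (μ : ℝ) (f : ℝ → X) (t : ℝ) : X :=
  if μ = 0 then f t
  else (Real.Gamma μ)⁻¹ • ∫ s in a..t, (dpsi a b ψ s * (ψ t - ψ s) ^ (μ - 1)) • f s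

/-- `P_α(t) x = ∫_0^∞ α θ M_α(θ) T(t^α θ) x dθ` for `0 < α < 1`. For `α = 1` the distribution
`M_α(θ) dθ` is the unit mass at `θ = 1`, and `P_1(t) = T(t)`. -/
def opP {X : Type*} [NormedAddCommGroup X] [NormedSpace ℝ X]
    (α : ℝ) (T : ℝ → X →L[ℝ] X) (t : ℝ) (x : X) : X :=
  if α = 1 then T t x
  else ∫ θ in Ioi (0 : ℝ), (α * θ * wrightM α θ) • T (t ^ α * θ) x

/-- `K_α(t) = t^{α-1} P_α(t)`. -/
def opK {X : Type*} [NormedAddCommGroup X] [NormedSpace ℝ X]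
    (α : ℝ) (T : ℝ → X →L[ℝ] X) (t : ℝ) (x : X) : X :=
  t ^ (α - 1) • opP α T t x

/-- The parameter `γ = α + β (1 - α)`. -/
def gam (α β : ℝ) : ℝ := α + β * (1 - α)

/-- `S_{α,β}(ψ(t) - ψ(a)) x`, that is the `ψ`-fractional integral of order `γ - α`, based at `a`,
of the function `s ↦ K_α(ψ(s) - ψ(a)) x`, evaluated at `t`. -/
def opS {X : Type*} [NormedAddCommGroup X] [NormedSpace ℝ X]
    (a b : ℝ) (ψ : ℝ → ℝ) (α β : ℝ) (T : ℝ → X →L[ℝ] X) (t : ℝ) (x : X) : X :=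
  fracIntegral a b ψ (gam α β - α) (fun s => opK α T (ψ s - ψ a) x) t

/-- The space `C^{1-γ;ψ}([a, b], X)`: continuous functions `q` on `(a, b]` such that
`(ψ(t) - ψ(a))^{1-γ} q(t)` extends to a continuous function on `[a, b]`. -/
def WeightedC (X : Type*) [NormedAddCommGroup X] [NormedSpace ℝ X]
    (a b : ℝ) (ψ : ℝ → ℝ) (γ : ℝ) : Set (Ioc a b → X) :=
  {q | Continuous q ∧ ∃ y : C(Icc a b, X), ∀ t : Ioc a b,
    y ⟨t, Ioc_subset_Icc_self t.2⟩ = (ψ t - ψ a) ^ (1 - γ) • q t}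

/-- The control space `L²([a, b], Y)`. -/
abbrev Control (Y : Type*) [NormedAddCommGroup Y] (a b : ℝ) : Type _ :=
  Lp Y 2 (volume.restrict (Icc a b))

/-- `q` is the mild solution with initial datum `x₀` and control `u`:
`q(t) = S_{α,β}(ψ(t) - ψ(a)) x₀ + ∫_a^t ψ'(s) K_α(ψ(t) - ψ(s)) B u(s) ds` on `(a, b]`. -/
def IsMildSolution {X Y : Type*} [NormedAddCommGroup X] [NormedSpace ℝ X]
    [NormedAddCommGroup Y] [NormedSpace ℝ Y]
    (a b : ℝ) (ψ : ℝ → ℝ) (α β : ℝ) (T : ℝ → X →L[ℝ] X) (B : Y →L[ℝ] X) (x₀ : X)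
    (q : WeightedC X a b ψ (gam α β)) (u : Control Y a b) : Prop :=
  ∀ t : Ioc a b, q.1 t = opS a b ψ α β T t x₀ +
    ∫ s in a..(t : ℝ), dpsi a b ψ s • opK α T (ψ t - ψ s) (B (u s))

/-- The admissible class of pairs (mild solution, control). -/
def admissible {X Y : Type*} [NormedAddCommGroup X] [NormedSpace ℝ X]
    [NormedAddCommGroup Y] [NormedSpace ℝ Y]
    (a b : ℝ) (ψ : ℝ → ℝ) (α β : ℝ) (T : ℝ → X →L[ℝ] X) (B : Y →L[ℝ] X) (x₀ : X) :
    Set (WeightedC X a b ψ (gam α β) × Control Y a b) :=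
  {p | IsMildSolution a b ψ α β T B x₀ p.1 p.2}

/-- The cost `J(q, u) = ‖q(b) - x_b‖² + lam ∫_a^b ‖u(t)‖² dt`. -/
def cost {X Y : Type*} [NormedAddCommGroup X] [NormedSpace ℝ X] [NormedAddCommGroup Y]
    {a b : ℝ} (hab : a < b) (ψ : ℝ → ℝ) (γ : ℝ) (xb : X) (lam : ℝ)
    (p : WeightedC X a b ψ γ × Control Y a b) : ℝ :=
  ‖p.1.1 ⟨b, right_mem_Ioc.2 hab⟩ - xb‖ ^ 2 + lam * ∫ t in a..b, ‖p.2 t‖ ^ 2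

end PsiHilfer

end

/-!
Every control `u ∈ L²` has exactly one mild solution, so the cost is a function of `u` alone, of
the form `‖d + L u‖² + lam ‖u‖²` with a bounded linear map `L : L² → X`. This function is
continuous and strongly convex: the squared norm of the Banach space `X` is convex, and the
parallelogram law holds in `L²`. Minimizing sequences are therefore Cauchy, and the minimizer exists
and is unique (`existsUnique_minimizer`); no weak compactness is needed.

What has to be proved about the state equation is that the mild solution formula makes sense and
lands in the weighted space (`IsTimeChange.mildFormula_mem`), and that `L` is bounded
(`exists_clm_volterra`). Both rest on `P_α` being a strongly continuous family of bounded operators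
on `[0, ∞)` (`exists_clm_opP`). As the semigroup may grow exponentially, this requires the Wright
function to decay faster than every exponential (`exists_abs_mul_wrightM_le`). Its power series
gives no decay, so it is turned into a contour integral: `α θ M_α(θ)` is `1 / π` times the imaginary
part of the integral of `exp (σ - θ σ^α)` over a ray from `0` into the left half-plane
(`mul_wrightM_eq`, by the reflection formula and termwise integration). The integrand is real on the
positive axis, so the ray may start at any `k > 0` without changing the imaginary part
(`wrightContour_im_eq`), and there `Re (σ^α)` is at least a constant times `k^α`.

For the control term, the kernel `(ψ(t) - ψ(s))^(α - 1)` is square integrable because `α > 1 / 2`.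
By the Cauchy-Schwarz inequality the Volterra integral converges, is bounded in `u`, and is the
uniform limit of its truncations away from the singularity, hence continuous
(`continuousOn_volterra`). For the initial datum, the substitution
`z = (ψ(s) - ψ(a)) / (ψ(t) - ψ(a))` shows that `(ψ(t) - ψ(a))^(1 - γ) S_{α,β}` is an integral over
`(0, 1)` against a beta density that depends continuously on `t` up to `t = a`
(`IsTimeChange.rpow_smul_opS_eq`, `continuousOn_scaledS`).
-/

namespace PsiHilfer

/-! ### Laplace transform of powers in the right half-plane -/

theorem integrableOn_rpow_mul_exp_neg {s c : ℝ} (hs : 0 ≤ s) (hc : 0 < c) :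
    IntegrableOn (fun r : ℝ => r ^ s * Real.exp (-c * r)) (Ioi 0) := by
  have := integrableOn_rpow_mul_exp_neg_mul_rpow (p := 1) (s := s) (b := c)
    (by linarith) one_pos hc
  simpa using this

theorem aestronglyMeasurable_cexp_mul_rpow (z : ℂ) {s : ℝ} (hs : 0 ≤ s) (μ : Measure ℝ) :
    AEStronglyMeasurable (fun r : ℝ => Complex.exp (-(z * r)) * ((r ^ s : ℝ) : ℂ)) μ := by
  have : Continuous (fun r : ℝ => Complex.exp (-(z * r)) * ((r ^ s : ℝ) : ℂ)) := by
    have := Real.continuous_rpow_const hs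
    fun_prop
  exact this.aestronglyMeasurable

theorem norm_cexp_mul_rpow (z : ℂ) (s : ℝ) {r : ℝ} (hr : 0 < r) :
    ‖Complex.exp (-(z * r)) * ((r ^ s : ℝ) : ℂ)‖ = r ^ s * Real.exp (-z.re * r) := by
  rw [norm_mul, Complex.norm_exp, Complex.norm_real, Real.norm_of_nonneg (by positivity), mul_comm]
  simp

theorem integrableOn_cexp_mul_rpow {z : ℂ} (hz : 0 < z.re) {s : ℝ} (hs : 0 ≤ s) :
    IntegrableOn (fun r : ℝ => Complex.exp (-(z * r)) * ((r ^ s : ℝ) : ℂ)) (Ioi 0) := by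
  refine (integrableOn_rpow_mul_exp_neg hs hz).mono'
    (aestronglyMeasurable_cexp_mul_rpow z hs _) ?_
  filter_upwards [ae_restrict_mem measurableSet_Ioi] with r hr
  exact (norm_cexp_mul_rpow z s hr).le

theorem hasDerivAt_laplace_rpow {z : ℂ} (hz : 0 < z.re) {s : ℝ} (hs : 0 ≤ s) :
    HasDerivAt (fun z : ℂ => ∫ r in Ioi (0 : ℝ), Complex.exp (-(z * r)) * ((r ^ s : ℝ) : ℂ))
      (-∫ r in Ioi (0 : ℝ), Complex.exp (-(z * r)) * ((r ^ (s + 1) : ℝ) : ℂ)) z := by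
  rw [← integral_neg]
  refine (hasDerivAt_integral_of_dominated_loc_of_deriv_le
    (s := {w : ℂ | z.re / 2 < w.re})
    (bound := fun r : ℝ => r ^ (s + 1) * Real.exp (-(z.re / 2) * r))
    (F := fun w (r : ℝ) => Complex.exp (-(w * r)) * ((r ^ s : ℝ) : ℂ))
    (F' := fun w (r : ℝ) => -(Complex.exp (-(w * r)) * ((r ^ (s + 1) : ℝ) : ℂ)))
    ?_ ?_ (integrableOn_cexp_mul_rpow hz hs) ?_ ?_ ?_ ?_).2
  · exact (isOpen_lt continuous_const Complex.continuous_re).mem_nhds (by simp; linarith)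
  · exact Eventually.of_forall fun w => aestronglyMeasurable_cexp_mul_rpow w hs _
  · exact (aestronglyMeasurable_cexp_mul_rpow z (by linarith) _).neg
  · filter_upwards [ae_restrict_mem measurableSet_Ioi] with r hr w hw
    have hr : 0 < r := hr
    rw [norm_neg, norm_cexp_mul_rpow w _ hr]
    have : z.re / 2 < w.re := hw
    gcongr
  · exact integrableOn_rpow_mul_exp_neg (by linarith) (by linarith)
  · filter_upwards [ae_restrict_mem measurableSet_Ioi] with r hr w hw
    have hr : 0 < r := hr
    have h1 : HasDerivAt (fun w : ℂ => -(w * r)) (-(1 * r)) w :=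
      ((hasDerivAt_id w).mul_const (r : ℂ)).neg
    convert! h1.cexp.mul_const ((r ^ s : ℝ) : ℂ) using 1
    rw [Real.rpow_add_one hr.ne']
    push_cast
    ring

/-- Integration by parts. -/
theorem mul_laplace_rpow_add_one {z : ℂ} (hz : 0 < z.re) {s : ℝ} (hs : 0 ≤ s) :
    z * ∫ r in Ioi (0 : ℝ), Complex.exp (-(z * r)) * ((r ^ (s + 1) : ℝ) : ℂ) =
      (s + 1) * ∫ r in Ioi (0 : ℝ), Complex.exp (-(z * r)) * ((r ^ s : ℝ) : ℂ) := by
  have i1 := integrableOn_cexp_mul_rpow hz (s := s + 1) (by linarith)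
  have i0 := integrableOn_cexp_mul_rpow hz hs
  have key := integral_Ioi_of_hasDerivAt_of_tendsto (a := 0) (m := (0 : ℂ))
    (f := fun r : ℝ => Complex.exp (-(z * r)) * ((r ^ (s + 1) : ℝ) : ℂ))
    (f' := fun r : ℝ => (s + 1) * (Complex.exp (-(z * r)) * ((r ^ s : ℝ) : ℂ)) -
      z * (Complex.exp (-(z * r)) * ((r ^ (s + 1) : ℝ) : ℂ))) ?_ ?_ ?_ ?_
  · rw [integral_sub (i0.const_mul _) (i1.const_mul _), integral_const_mul,
      integral_const_mul] at key
    have h0 : (0 : ℝ) ^ (s + 1) = 0 := Real.zero_rpow (by linarith)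
    rw [h0] at key
    simp only [Complex.ofReal_zero, mul_zero, sub_zero] at key
    exact (sub_eq_zero.1 key).symm
  · have : Continuous (fun r : ℝ => Complex.exp (-(z * r)) * ((r ^ (s + 1) : ℝ) : ℂ)) := by
      have := Real.continuous_rpow_const (show 0 ≤ s + 1 by linarith)
      fun_prop
    exact this.continuousWithinAt
  · intro r hr
    have hr : 0 < r := hr
    have h1 : HasDerivAt (fun r : ℝ => -(z * (r : ℂ))) (-(z * 1)) r :=
      ((Complex.ofRealCLM.hasDerivAt (x := r)).const_mul z).neg
    have h2 : HasDerivAt (fun r : ℝ => ((r ^ (s + 1) : ℝ) : ℂ))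
        (((s + 1) * r ^ (s + 1 - 1) : ℝ) : ℂ) r :=
      (Real.hasDerivAt_rpow_const (Or.inl hr.ne')).ofReal_comp
    convert! h1.cexp.mul h2 using 1
    rw [add_sub_cancel_right]
    push_cast
    ring
  · exact (i0.const_mul _).sub (i1.const_mul _)
  · rw [tendsto_zero_iff_norm_tendsto_zero]
    refine (tendsto_rpow_mul_exp_neg_mul_atTop_nhds_zero (s + 1) z.re hz).congr' ?_
    filter_upwards [eventually_gt_atTop 0] with r hr
    exact (norm_cexp_mul_rpow z _ hr).symm

/-- The Laplace transform of `r ↦ r ^ s` at complex points: `z ^ (s + 1)` times the transform has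
zero derivative on the right half-plane, and its value at `z = 1` is Euler's integral. -/
theorem laplace_rpow {z : ℂ} (hz : 0 < z.re) {s : ℝ} (hs : 0 ≤ s) :
    z ^ ((s : ℂ) + 1) * ∫ r in Ioi (0 : ℝ), Complex.exp (-(z * r)) * ((r ^ s : ℝ) : ℂ) =
      Real.Gamma (s + 1) := by
  set F : ℂ → ℂ := fun z => z ^ ((s : ℂ) + 1) *
    ∫ r in Ioi (0 : ℝ), Complex.exp (-(z * r)) * ((r ^ s : ℝ) : ℂ) with hF
  have hd : ∀ w : ℂ, 0 < w.re → HasDerivAt F 0 w := by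
    intro w hw
    have h1 : HasDerivAt (fun w : ℂ => w ^ ((s : ℂ) + 1))
        (((s : ℂ) + 1) * w ^ ((s : ℂ) + 1 - 1) * 1) w :=
      (hasDerivAt_id w).cpow_const (Or.inl hw)
    convert! h1.mul (hasDerivAt_laplace_rpow hw hs) using 1
    have hw0 : w ≠ 0 := by rintro rfl; simp at hw
    have := mul_laplace_rpow_add_one hw hs
    rw [add_sub_cancel_right, Complex.cpow_add _ _ hw0, Complex.cpow_one]
    linear_combination (w ^ (s : ℂ)) * this
  have hc : F z = F 1 := by
    refine IsOpen.is_const_of_deriv_eq_zero (s := {w : ℂ | 0 < w.re})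
      (isOpen_lt continuous_const Complex.continuous_re)
      (convex_halfSpace_re_gt 0).isPreconnected
      (fun w hw => (hd w hw).differentiableAt.differentiableWithinAt)
      (fun w hw => (hd w hw).deriv) hz (by simp)
  change F z = _
  rw [hc, hF, Real.Gamma_eq_integral (by linarith), ← integral_complex_ofReal]
  simp

/-! ### Points of the shifted ray -/

/-- The point at distance `r` on the ray from `k` in the direction `e^{iδ}`. -/
noncomputable def rayPt (δ k r : ℝ) : ℂ := k + r * Complex.exp (δ * Complex.I)

theorem rayPt_re (δ k r : ℝ) : (rayPt δ k r).re = k + r * Real.cos δ := by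
  simp [rayPt, Complex.exp_ofReal_mul_I_re]

theorem rayPt_im (δ k r : ℝ) : (rayPt δ k r).im = r * Real.sin δ := by
  simp [rayPt, Complex.exp_ofReal_mul_I_im]

theorem mul_sin_le_norm_rayPt (δ k r : ℝ) : k * Real.sin δ ≤ ‖rayPt δ k r‖ := by
  refine Real.le_sqrt_of_sq_le ?_ |>.trans_eq (Complex.norm_def _).symm
  rw [Complex.normSq_apply, rayPt_re, rayPt_im]
  have := Real.sin_sq_add_cos_sq δ
  have h : (k + r * Real.cos δ) * (k + r * Real.cos δ) + r * Real.sin δ * (r * Real.sin δ) -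
      (k * Real.sin δ) ^ 2 = (r + k * Real.cos δ) ^ 2 := by
    linear_combination (r ^ 2 - k ^ 2) * this
  linarith [sq_nonneg (r + k * Real.cos δ)]

theorem rayPt_mem_slitPlane {δ k r : ℝ} (hδ : 0 < Real.sin δ) (hr : 0 ≤ r) (hkr : 0 < k ∨ 0 < r) :
    rayPt δ k r ∈ Complex.slitPlane := by
  rcases hr.eq_or_lt with rfl | hr
  · left
    have : 0 < k := by simpa using hkr
    simpa [rayPt_re] using this
  · right
    rw [rayPt_im]
    positivity

/-- A point of the ray has argument in `[0, δ]`: rotating by `-δ` moves it below the real axis. -/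
theorem arg_rayPt_mem {δ k r : ℝ} (hδ0 : 0 < δ) (hδ : δ < Real.pi) (hk : 0 ≤ k) (hr : 0 ≤ r) :
    (rayPt δ k r).arg ∈ Icc 0 δ := by
  have hs : 0 < Real.sin δ := Real.sin_pos_of_pos_of_lt_pi hδ0 hδ
  have h0 : 0 ≤ (rayPt δ k r).arg := by
    rw [Complex.arg_nonneg_iff, rayPt_im]; positivity
  refine ⟨h0, ?_⟩
  by_contra! hlt
  have hne : rayPt δ k r ≠ 0 := by
    intro h
    rw [h, Complex.arg_zero] at hlt
    linarith
  have hn : 0 < ‖rayPt δ k r‖ := norm_pos_iff.2 hne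
  have h1 : 0 < Real.sin ((rayPt δ k r).arg - δ) :=
    Real.sin_pos_of_pos_of_lt_pi (by linarith) (by linarith [Complex.arg_le_pi (rayPt δ k r)])
  rw [Real.sin_sub] at h1
  have h2 : 0 < ‖rayPt δ k r‖ * Real.sin (rayPt δ k r).arg * Real.cos δ -
      ‖rayPt δ k r‖ * Real.cos (rayPt δ k r).arg * Real.sin δ := by
    nlinarith [mul_pos hn h1]
  rw [Complex.norm_mul_sin_arg, Complex.norm_mul_cos_arg, rayPt_re, rayPt_im] at h2
  nlinarith [mul_nonneg hk hs.le]

/-- Since `α * arg σ` stays in `[0, α δ]`, the real part of `σ ^ α` grows like `k ^ α`. -/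
theorem le_re_rayPt_cpow {α δ k r : ℝ} (hα : 0 < α) (hδ0 : 0 < δ) (hδ : δ < Real.pi)
    (hαδ : α * δ < Real.pi / 2) (hk : 0 ≤ k) (hr : 0 ≤ r) :
    (k * Real.sin δ) ^ α * Real.cos (α * δ) ≤ (rayPt δ k r ^ (α : ℂ)).re := by
  have hs : 0 < Real.sin δ := Real.sin_pos_of_pos_of_lt_pi hδ0 hδ
  obtain ⟨ha0, ha⟩ := arg_rayPt_mem hδ0 hδ hk hr
  have hπ : α * δ ≤ Real.pi := by linarith [Real.pi_pos]
  rw [Complex.cpow_ofReal, Complex.re_ofReal_mul]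
  simp only [Complex.add_re, Complex.ofReal_re, Complex.mul_re, Complex.I_re, mul_zero,
    Complex.ofReal_im, Complex.I_im, mul_one, sub_self, add_zero]
  have hc : 0 ≤ Real.cos (α * δ) :=
    (Real.cos_pos_of_mem_Ioo ⟨by linarith [mul_pos hα hδ0, Real.pi_pos], hαδ⟩).le
  refine mul_le_mul ?_ ?_ hc (by positivity)
  · exact Real.rpow_le_rpow (by positivity) (mul_sin_le_norm_rayPt δ k r) hα.le
  · rw [mul_comm (Complex.arg _)]
    exact Real.cos_le_cos_of_nonneg_of_le_pi (by positivity) hπ (by gcongr)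

/-! ### The contour integral of `exp (σ - θ σ ^ α)` -/

/-- The integrand `exp (σ - θ σ ^ α)`, with the principal branch of the power. -/
noncomputable def wrightInt (α θ : ℝ) (σ : ℂ) : ℂ := Complex.exp (σ - θ * σ ^ (α : ℂ))

theorem norm_wrightInt_rayPt_le {α δ k r θ : ℝ} (hα : 0 < α) (hδ0 : 0 < δ) (hδ : δ < Real.pi)
    (hαδ : α * δ < Real.pi / 2) (hk : 0 ≤ k) (hr : 0 ≤ r) (hθ : 0 ≤ θ) :
    ‖wrightInt α θ (rayPt δ k r)‖ ≤
      Real.exp (k - θ * ((k * Real.sin δ) ^ α * Real.cos (α * δ))) * Real.exp (Real.cos δ * r) := by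
  rw [wrightInt, Complex.norm_exp, ← Real.exp_add, Complex.sub_re, Complex.re_ofReal_mul, rayPt_re]
  have := mul_le_mul_of_nonneg_left (le_re_rayPt_cpow hα hδ0 hδ hαδ hk hr) hθ
  gcongr
  linarith

/-- The cruder bound without decay in `θ`, which stays integrable uniformly for bounded `k`. -/
theorem norm_wrightInt_rayPt_le' {α δ k r θ : ℝ} (hα : 0 < α) (hδ0 : 0 < δ) (hδ : δ < Real.pi)
    (hαδ : α * δ < Real.pi / 2) (hk : 0 ≤ k) (hr : 0 ≤ r) (hθ : 0 ≤ θ) :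
    ‖wrightInt α θ (rayPt δ k r)‖ ≤ Real.exp k * Real.exp (Real.cos δ * r) := by
  refine (norm_wrightInt_rayPt_le hα hδ0 hδ hαδ hk hr hθ).trans ?_
  have hs : 0 < Real.sin δ := Real.sin_pos_of_pos_of_lt_pi hδ0 hδ
  have hc : 0 ≤ Real.cos (α * δ) :=
    (Real.cos_pos_of_mem_Ioo ⟨by linarith [mul_pos hα hδ0, Real.pi_pos], hαδ⟩).le
  gcongr
  have : 0 ≤ θ * ((k * Real.sin δ) ^ α * Real.cos (α * δ)) := by positivity
  linarith

theorem hasDerivAt_wrightInt (α θ : ℝ) {σ : ℂ} (hσ : σ ∈ Complex.slitPlane) :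
    HasDerivAt (wrightInt α θ)
      (wrightInt α θ σ * (1 - θ * (α * σ ^ ((α : ℂ) - 1)))) σ := by
  have h1 : HasDerivAt (fun σ : ℂ => σ ^ (α : ℂ)) ((α : ℂ) * σ ^ ((α : ℂ) - 1) * 1) σ :=
    (hasDerivAt_id σ).cpow_const hσ
  convert! ((hasDerivAt_id σ).sub (h1.const_mul (θ : ℂ))).cexp using 1
  simp [wrightInt]

theorem continuousOn_wrightInt_rayPt (α θ : ℝ) {δ : ℝ} (hδ : 0 < Real.sin δ) :
    ContinuousOn (fun p : ℝ × ℝ => wrightInt α θ (rayPt δ p.1 p.2))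
      {p | 0 ≤ p.2 ∧ (0 < p.1 ∨ 0 < p.2)} := by
  intro p hp
  have h1 : ContinuousAt (wrightInt α θ) (rayPt δ p.1 p.2) :=
    (hasDerivAt_wrightInt α θ (rayPt_mem_slitPlane hδ hp.1 hp.2)).continuousAt
  have h2 : ContinuousAt (fun p : ℝ × ℝ => rayPt δ p.1 p.2) p := by
    unfold rayPt; fun_prop
  exact (ContinuousAt.comp (f := fun p : ℝ × ℝ => rayPt δ p.1 p.2) h1 h2).continuousWithinAt

theorem aestronglyMeasurable_wrightInt (α θ k δ : ℝ) (hδ : 0 < Real.sin δ) :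
    AEStronglyMeasurable (fun r => wrightInt α θ (rayPt δ k r)) (volume.restrict (Ioi 0)) := by
  refine ContinuousOn.aestronglyMeasurable ?_ measurableSet_Ioi
  exact (continuousOn_wrightInt_rayPt α θ hδ).comp (f := fun r : ℝ => ((k, r) : ℝ × ℝ))
    (by fun_prop) fun r hr => ⟨le_of_lt hr, Or.inr hr⟩

/-- The integral of `exp (σ - θ σ ^ α)` along the ray from `k` in the direction `e^{iδ}`. -/
noncomputable def wrightContour (α δ θ k : ℝ) : ℂ :=
  ∫ r in Ioi (0 : ℝ), wrightInt α θ (rayPt δ k r) * Complex.exp (δ * Complex.I)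

section contour

variable {α δ θ : ℝ}

theorem integrableOn_wrightInt (hα : 0 < α) (hδ0 : Real.pi / 2 < δ) (hδ : δ < Real.pi)
    (hαδ : α * δ < Real.pi / 2) (hθ : 0 ≤ θ) {k : ℝ} (hk : 0 ≤ k) :
    IntegrableOn (fun r => wrightInt α θ (rayPt δ k r)) (Ioi 0) := by
  have hδp : 0 < δ := by linarith [Real.pi_pos]
  have hc : Real.cos δ < 0 := Real.cos_neg_of_pi_div_two_lt_of_lt hδ0 (by linarith)
  refine Integrable.mono' ((integrableOn_exp_mul_Ioi hc 0).const_mul (Real.exp k))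
    (aestronglyMeasurable_wrightInt α θ k δ (Real.sin_pos_of_pos_of_lt_pi hδp hδ)) ?_
  filter_upwards [ae_restrict_mem measurableSet_Ioi] with r hr
  exact norm_wrightInt_rayPt_le' hα hδp hδ hαδ hk (le_of_lt hr) hθ

theorem norm_wrightContour_le (hα : 0 < α) (hδ0 : Real.pi / 2 < δ) (hδ : δ < Real.pi)
    (hαδ : α * δ < Real.pi / 2) (hθ : 0 ≤ θ) {k : ℝ} (hk : 0 ≤ k) :
    ‖wrightContour α δ θ k‖ ≤ Real.exp (k - θ * ((k * Real.sin δ) ^ α * Real.cos (α * δ))) *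
      (-Real.cos δ)⁻¹ := by
  have hδp : 0 < δ := by linarith [Real.pi_pos]
  have hc : Real.cos δ < 0 := Real.cos_neg_of_pi_div_two_lt_of_lt hδ0 (by linarith)
  refine (norm_integral_le_of_norm_le ((integrableOn_exp_mul_Ioi hc 0).const_mul _)
    (g := fun r => Real.exp (k - θ * ((k * Real.sin δ) ^ α * Real.cos (α * δ))) *
      Real.exp (Real.cos δ * r)) ?_).trans_eq ?_
  · filter_upwards [ae_restrict_mem measurableSet_Ioi] with r hr
    rw [norm_mul, Complex.norm_exp_ofReal_mul_I, mul_one]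
    exact norm_wrightInt_rayPt_le hα hδp hδ hαδ hk (le_of_lt hr) hθ
  · rw [integral_const_mul, integral_exp_mul_Ioi hc]
    simp [neg_div, inv_neg]

theorem continuousOn_wrightContour (hα : 0 < α) (hδ0 : Real.pi / 2 < δ) (hδ : δ < Real.pi)
    (hαδ : α * δ < Real.pi / 2) (hθ : 0 ≤ θ) (K : ℝ) :
    ContinuousOn (wrightContour α δ θ) (Icc 0 K) := by
  have hδp : 0 < δ := by linarith [Real.pi_pos]
  have hc : Real.cos δ < 0 := Real.cos_neg_of_pi_div_two_lt_of_lt hδ0 (by linarith)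
  have hs := Real.sin_pos_of_pos_of_lt_pi hδp hδ
  refine continuousOn_of_dominated
    (bound := fun r => Real.exp K * Real.exp (Real.cos δ * r)) ?_ ?_
    ((integrableOn_exp_mul_Ioi hc 0).const_mul _) ?_
  · exact fun k _ => (aestronglyMeasurable_wrightInt α θ k δ hs).mul_const _
  · intro k hk
    filter_upwards [ae_restrict_mem measurableSet_Ioi] with r hr
    rw [norm_mul, Complex.norm_exp_ofReal_mul_I, mul_one]
    refine (norm_wrightInt_rayPt_le' hα hδp hδ hαδ hk.1 (le_of_lt hr) hθ).trans ?_
    have := hk.2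
    gcongr
  · filter_upwards [ae_restrict_mem measurableSet_Ioi] with r hr
    refine ContinuousOn.mul_const ?_ _
    exact (continuousOn_wrightInt_rayPt α θ hs).comp (f := fun k : ℝ => ((k, r) : ℝ × ℝ))
      (by fun_prop) fun k _ => ⟨le_of_lt hr, Or.inr hr⟩

/-- Moving the base point of the ray: the `k`-derivative of the integrand is its `r`-derivative
up to the factor `e^{iδ}`, so only the boundary term at `r = 0` remains. -/
theorem hasDerivAt_wrightContour (hα : 0 < α) (hα1 : α < 1) (hδ0 : Real.pi / 2 < δ)
    (hδ : δ < Real.pi) (hαδ : α * δ < Real.pi / 2) (hθ : 0 ≤ θ) {k : ℝ} (hk : 0 < k) :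
    HasDerivAt (wrightContour α δ θ) (-wrightInt α θ k) k := by
  have hδp : 0 < δ := by linarith [Real.pi_pos]
  have hc : Real.cos δ < 0 := Real.cos_neg_of_pi_div_two_lt_of_lt hδ0 (by linarith)
  have hs := Real.sin_pos_of_pos_of_lt_pi hδp hδ
  set D : ℂ → ℂ := fun σ => wrightInt α θ σ * (1 - θ * (α * σ ^ ((α : ℂ) - 1))) with hD
  set ω : ℂ := Complex.exp (δ * Complex.I) with hω
  set C : ℝ := 1 + θ * (α * (k / 2 * Real.sin δ) ^ (α - 1)) with hC
  have hDbound : ∀ k' ∈ Ioo (k / 2) (2 * k), ∀ r : ℝ, 0 ≤ r →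
      ‖D (rayPt δ k' r)‖ ≤ Real.exp (2 * k) * C * Real.exp (Real.cos δ * r) := by
    intro k' hk' r hr
    have hk'0 : 0 < k' := by linarith [hk'.1]
    rw [hD, norm_mul]
    have e1 : ‖wrightInt α θ (rayPt δ k' r)‖ ≤ Real.exp (2 * k) * Real.exp (Real.cos δ * r) := by
      refine (norm_wrightInt_rayPt_le' hα hδp hδ hαδ hk'0.le hr hθ).trans ?_
      have := hk'.2.le
      gcongr
    have e2 : ‖1 - (θ : ℂ) * (α * rayPt δ k' r ^ ((α : ℂ) - 1))‖ ≤ C := by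
      refine (norm_sub_le _ _).trans ?_
      rw [norm_one, norm_mul, norm_mul, Complex.norm_real, Complex.norm_real,
        Real.norm_of_nonneg hθ, Real.norm_of_nonneg hα.le,
        show ((α : ℂ) - 1) = ((α - 1 : ℝ) : ℂ) by push_cast; ring, Complex.norm_cpow_real]
      have : k / 2 * Real.sin δ ≤ ‖rayPt δ k' r‖ :=
        le_trans (by have := hk'.1.le; gcongr) (mul_sin_le_norm_rayPt δ k' r)
      have h3 := Real.rpow_le_rpow_of_nonpos (z := α - 1) (by positivity) this (by linarith)
      rw [hC]
      gcongr
    calc _ ≤ (Real.exp (2 * k) * Real.exp (Real.cos δ * r)) * C :=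
          mul_le_mul e1 e2 (norm_nonneg _) (by positivity)
      _ = _ := by ring
  have hkmem : k ∈ Ioo (k / 2) (2 * k) := ⟨by linarith, by linarith⟩
  have hmeas : AEStronglyMeasurable (fun r => D (rayPt δ k r)) (volume.restrict (Ioi 0)) := by
    refine (aestronglyMeasurable_wrightInt α θ k δ hs).mul ?_
    refine ContinuousOn.aestronglyMeasurable ?_ measurableSet_Ioi
    intro r hr
    have : ContinuousAt (fun r => rayPt δ k r) r := by unfold rayPt; fun_prop
    have h2 : ContinuousAt (fun r => rayPt δ k r ^ ((α : ℂ) - 1)) r :=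
      ContinuousAt.cpow this continuousAt_const (rayPt_mem_slitPlane hs (le_of_lt hr) (Or.inl hk))
    exact (continuousAt_const.sub (continuousAt_const.mul
      (continuousAt_const.mul h2))).continuousWithinAt
  have hDint : IntegrableOn (fun r => D (rayPt δ k r) * ω) (Ioi 0) := by
    refine Integrable.mul_const (Integrable.mono'
      ((integrableOn_exp_mul_Ioi hc 0).const_mul (Real.exp (2 * k) * C)) hmeas ?_) _
    filter_upwards [ae_restrict_mem measurableSet_Ioi] with r hr
    exact hDbound k hkmem r (le_of_lt hr)
  have hderiv : HasDerivAt (wrightContour α δ θ) (∫ r in Ioi (0 : ℝ), D (rayPt δ k r) * ω) k := by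
    refine (hasDerivAt_integral_of_dominated_loc_of_deriv_le (𝕜 := ℝ)
      (s := Ioo (k / 2) (2 * k))
      (bound := fun r => Real.exp (2 * k) * C * Real.exp (Real.cos δ * r))
      (F := fun k r => wrightInt α θ (rayPt δ k r) * ω)
      (F' := fun k r => D (rayPt δ k r) * ω)
      (Ioo_mem_nhds hkmem.1 hkmem.2)
      (Eventually.of_forall fun k' => (aestronglyMeasurable_wrightInt α θ k' δ hs).mul_const _)
      ((integrableOn_wrightInt hα hδ0 hδ hαδ hθ hk.le).mul_const _)
      (hmeas.mul_const _) ?_ ((integrableOn_exp_mul_Ioi hc 0).const_mul _) ?_).2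
    · filter_upwards [ae_restrict_mem measurableSet_Ioi] with r hr k' hk'
      rw [norm_mul, hω, Complex.norm_exp_ofReal_mul_I, mul_one]
      exact hDbound k' hk' r (le_of_lt hr)
    · filter_upwards [ae_restrict_mem measurableSet_Ioi] with r hr k' hk'
      refine HasDerivAt.mul_const ?_ ω
      have h1 : HasDerivAt (fun k' : ℝ => rayPt δ k' r) 1 k' := by
        unfold rayPt
        simpa using (Complex.ofRealCLM.hasDerivAt (x := k')).add_const (r * ω)
      have hmem : rayPt δ k' r ∈ Complex.slitPlane :=
        rayPt_mem_slitPlane hs (le_of_lt hr) (Or.inr hr)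
      have h2 := hasDerivAt_wrightInt α θ hmem
      simpa [Function.comp_def, hD] using h2.comp k' h1
  have hint : ∫ r in Ioi (0 : ℝ), D (rayPt δ k r) * ω = 0 - wrightInt α θ (rayPt δ k 0) := by
    refine integral_Ioi_of_hasDerivAt_of_tendsto' (f := fun r => wrightInt α θ (rayPt δ k r))
      ?_ hDint ?_
    · intro r hr
      have h1 : HasDerivAt (fun r : ℝ => rayPt δ k r) ω r := by
        unfold rayPt
        simpa using ((Complex.ofRealCLM.hasDerivAt (x := r)).mul_const ω).const_add (k : ℂ)
      exact (hasDerivAt_wrightInt α θ (rayPt_mem_slitPlane hs hr (Or.inl hk))).comp r h1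
    · have hlim : Tendsto (fun r => Real.exp k * Real.exp (Real.cos δ * r)) atTop
          (𝓝 (Real.exp k * 0)) :=
        (Real.tendsto_exp_atBot.comp ((tendsto_const_mul_atBot_of_neg hc).2 tendsto_id)).const_mul _
      rw [mul_zero] at hlim
      refine squeeze_zero_norm' ?_ hlim
      filter_upwards [eventually_ge_atTop 0] with r hr
      exact norm_wrightInt_rayPt_le' hα hδp hδ hαδ hk.le hr hθ
  rw [hint] at hderiv
  simpa [rayPt] using hderiv

/-- The imaginary part of the contour integral does not depend on the base point, because the
integrand is real on the positive axis. -/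
theorem wrightContour_im_eq (hα : 0 < α) (hα1 : α < 1) (hδ0 : Real.pi / 2 < δ) (hδ : δ < Real.pi)
    (hαδ : α * δ < Real.pi / 2) (hθ : 0 ≤ θ) {k : ℝ} (hk : 0 < k) :
    (wrightContour α δ θ k).im = (wrightContour α δ θ 0).im := by
  have hd : ∀ x : ℝ, 0 < x → HasDerivAt (fun k => (wrightContour α δ θ k).im) 0 x := by
    intro x hx
    have := Complex.imCLM.hasFDerivAt.comp_hasDerivAt x
      (hasDerivAt_wrightContour hα hα1 hδ0 hδ hαδ hθ hx)
    convert! this using 1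
    have : wrightInt α θ x = ((Real.exp (x - θ * x ^ α) : ℝ) : ℂ) := by
      rw [wrightInt]
      push_cast
      rw [Complex.ofReal_cpow hx.le]
    rw [this]
    simp only [Complex.imCLM_apply, Complex.neg_im, Complex.ofReal_im, neg_zero]
  obtain ⟨c, hc, h⟩ := exists_deriv_eq_slope (fun k => (wrightContour α δ θ k).im) hk
    (Complex.continuous_im.comp_continuousOn (continuousOn_wrightContour hα hδ0 hδ hαδ hθ k))
    fun x hx => (hd x hx.1).differentiableAt.differentiableWithinAt
  rw [(hd c hc.1).deriv, eq_comm, div_eq_zero_iff] at h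
  rcases h with h | h <;> linarith

end contour

/-! ### Integral representation and decay of the Wright function -/

/-- As `α < 1`, the linear term `c r` dominates `θ r ^ α` at infinity. -/
theorem integrableOn_exp_rpow_mul_exp {α θ c : ℝ} (hα : 0 < α) (hα1 : α < 1) (hc : c < 0) :
    IntegrableOn (fun r : ℝ => Real.exp (θ * r ^ α) * Real.exp (c * r)) (Ioi 0) := by
  refine integrable_of_isBigO_exp_neg (b := -c / 2) (by linarith) ?_ ?_
  · have := Real.continuous_rpow_const hα.le
    exact Continuous.continuousOn (by fun_prop)
  · have h1 : Tendsto (fun r : ℝ => θ * r ^ (-(1 - α))) atTop (𝓝 (θ * 0)) :=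
      (tendsto_rpow_neg_atTop (by linarith)).const_mul θ
    rw [mul_zero] at h1
    refine Asymptotics.IsBigO.of_bound 1 ?_
    filter_upwards [h1.eventually_lt_const (show 0 < -c / 2 by linarith), eventually_gt_atTop 0]
      with r hr hr0
    rw [one_mul, ← Real.exp_add, Real.norm_of_nonneg (Real.exp_pos _).le,
      Real.norm_of_nonneg (Real.exp_pos _).le]
    have h2 : r ^ α = r ^ (-(1 - α)) * r := by
      rw [← Real.rpow_add_one hr0.ne']; congr 1; ring
    gcongr
    rw [h2]
    nlinarith

theorem rayPt_zero_cpow (α : ℝ) {δ : ℝ} (hδ0 : 0 < δ) (hδ : δ < Real.pi) {r : ℝ} (hr : 0 < r) :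
    rayPt δ 0 r ^ (α : ℂ) = ((r ^ α : ℝ) : ℂ) * Complex.exp (α * δ * Complex.I) := by
  have hlog : Complex.log (Complex.exp (δ * Complex.I)) = δ * Complex.I :=
    Complex.log_exp (by simp; linarith) (by simp; linarith)
  have hne := Complex.exp_ne_zero (δ * Complex.I)
  rw [rayPt, Complex.ofReal_zero, zero_add, Complex.cpow_def_of_ne_zero
    (mul_ne_zero (by exact_mod_cast hr.ne') hne), Complex.log_ofReal_mul hr hne, hlog,
    Real.rpow_def_of_pos hr, Complex.ofReal_exp, ← Complex.exp_add]
  congr 1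
  push_cast
  ring

/-- `laplace_rpow` at `z = -e^{iδ} = e^{i(δ - π)}`, whose principal argument is `δ - π`. -/
theorem laplace_rpow_neg_exp {δ : ℝ} (hδ0 : Real.pi / 2 < δ) (hδ : δ < Real.pi) {s : ℝ}
    (hs : 0 ≤ s) :
    Complex.exp (δ * (s + 1) * Complex.I) *
      ∫ r in Ioi (0 : ℝ), Complex.exp (r * Complex.exp (δ * Complex.I)) * ((r ^ s : ℝ) : ℂ) =
    Complex.exp ((Real.pi * (s + 1) : ℝ) * Complex.I) * Real.Gamma (s + 1) := by
  have hz : -Complex.exp (δ * Complex.I) = Complex.exp (((δ - Real.pi : ℝ) : ℂ) * Complex.I) := by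
    push_cast
    rw [sub_mul, Complex.exp_sub, Complex.exp_pi_mul_I, div_neg, div_one]
  have hre : 0 < (-Complex.exp (δ * Complex.I)).re := by
    rw [Complex.neg_re, Complex.exp_ofReal_mul_I_re]
    have := Real.cos_neg_of_pi_div_two_lt_of_lt hδ0 (by linarith)
    linarith
  have h := laplace_rpow hre hs
  have hlog : Complex.log (-Complex.exp (δ * Complex.I)) = ((δ - Real.pi : ℝ) : ℂ) * Complex.I := by
    rw [hz]
    exact Complex.log_exp (by simp; linarith) (by simp; linarith)
  rw [Complex.cpow_def_of_ne_zero (by rw [hz]; exact Complex.exp_ne_zero _), hlog] at h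
  rw [← h, ← mul_assoc, ← Complex.exp_add]
  congr 1
  · congr 1
    push_cast
    ring
  · refine integral_congr_ae (Eventually.of_forall fun r => ?_)
    simp only
    congr 2
    ring

/-- Expansion of the contour integral from `0` in powers of `θ`. -/
theorem hasSum_wrightContour_zero {α δ : ℝ} (hα : 0 < α) (hα1 : α < 1) (hδ0 : Real.pi / 2 < δ)
    (hδ : δ < Real.pi) {θ : ℝ} (hθ : 0 ≤ θ) :
    HasSum (fun n : ℕ => (((-θ) ^ n / n.factorial : ℝ) : ℂ) *
      (Complex.exp ((Real.pi * (α * n + 1) : ℝ) * Complex.I) * Real.Gamma (α * n + 1)))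
      (wrightContour α δ θ 0) := by
  have hδp : 0 < δ := by linarith [Real.pi_pos]
  have hc : Real.cos δ < 0 := Real.cos_neg_of_pi_div_two_lt_of_lt hδ0 (by linarith)
  have key := hasSum_integral_of_dominated_convergence (μ := volume.restrict (Ioi (0 : ℝ)))
    (F := fun (n : ℕ) (r : ℝ) => (((-θ) ^ n / n.factorial : ℝ) : ℂ) *
      (Complex.exp (δ * ((α * n : ℝ) + 1) * Complex.I) *
      (Complex.exp (r * Complex.exp (δ * Complex.I)) * ((r ^ (α * n) : ℝ) : ℂ))))
    (f := fun r => wrightInt α θ (rayPt δ 0 r) * Complex.exp (δ * Complex.I))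
    (fun n r => (θ * r ^ α) ^ n / n.factorial * Real.exp (Real.cos δ * r)) ?_ ?_ ?_ ?_ ?_
  · convert! key using 2 with n
    rw [integral_const_mul, integral_const_mul, laplace_rpow_neg_exp hδ0 hδ (by positivity)]
  · intro n
    have := Real.continuous_rpow_const (show 0 ≤ α * n by positivity)
    exact Continuous.aestronglyMeasurable (by fun_prop)
  · intro n
    filter_upwards [ae_restrict_mem measurableSet_Ioi] with r hr
    have hr : 0 < r := hr
    have h1 : ‖Complex.exp (δ * ((α * n : ℝ) + 1) * Complex.I)‖ = 1 := by
      rw [← Complex.norm_exp_ofReal_mul_I (δ * (α * n + 1))]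
      push_cast
      rfl
    rw [norm_mul, norm_mul, norm_mul, h1, Complex.norm_exp, Complex.norm_real, Complex.norm_real,
      Complex.re_ofReal_mul, Complex.exp_ofReal_mul_I_re, one_mul, Real.norm_eq_abs, abs_div,
      abs_pow, abs_neg, abs_of_nonneg hθ, Real.norm_of_nonneg (by positivity : 0 ≤ r ^ (α * n)),
      Nat.abs_cast, mul_pow, ← Real.rpow_mul_natCast hr.le, mul_comm r]
    exact le_of_eq (by ring)
  · refine Eventually.of_forall fun r => ?_
    exact (Real.summable_pow_div_factorial _).mul_right _
  · simp_rw [tsum_mul_right]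
    have h (x : ℝ) : ∑' n : ℕ, x ^ n / n.factorial = Real.exp x := by
      rw [Real.exp_eq_exp_ℝ, NormedSpace.exp_eq_tsum_div]
    simp_rw [h]
    exact integrableOn_exp_rpow_mul_exp hα hα1 hc
  · filter_upwards [ae_restrict_mem measurableSet_Ioi] with r hr
    have hr : 0 < r := hr
    have h1 := NormedSpace.expSeries_div_hasSum_exp
      (-(θ : ℂ) * (((r ^ α : ℝ) : ℂ) * Complex.exp (α * δ * Complex.I)))
    rw [← Complex.exp_eq_exp_ℂ] at h1
    convert! h1.mul_left (Complex.exp (r * Complex.exp (δ * Complex.I)) *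
      Complex.exp (δ * Complex.I)) using 1
    · ext n
      have h2 : Complex.exp (δ * ((α * n : ℝ) + 1) * Complex.I) =
          Complex.exp (α * δ * Complex.I) ^ n * Complex.exp (δ * Complex.I) := by
        rw [← Complex.exp_nat_mul, ← Complex.exp_add]
        congr 1
        push_cast
        ring
      rw [h2, Real.rpow_mul_natCast hr.le]
      push_cast
      ring
    · rw [wrightInt, rayPt_zero_cpow α hδp hδ hr, rayPt, sub_eq_add_neg, Complex.exp_add]
      simp only [Complex.ofReal_zero, zero_add, neg_mul]
      ring

/-- Euler's reflection formula, valid at all `s > 0` because `Real.Gamma` vanishes at its poles. -/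
theorem inv_Gamma_one_sub {s : ℝ} (hs : 0 < s) :
    (Real.Gamma (1 - s))⁻¹ = Real.Gamma s * Real.sin (Real.pi * s) / Real.pi := by
  have h := Real.Gamma_mul_Gamma_one_sub s
  have h1 := (Real.Gamma_pos_of_pos hs).ne'
  have hπ := Real.pi_pos.ne'
  by_cases h0 : Real.sin (Real.pi * s) = 0
  · rw [h0, div_zero, mul_eq_zero, or_iff_right h1] at h
    simp [h, h0]
  · have h2 : Real.Gamma (1 - s) = Real.pi / (Real.Gamma s * Real.sin (Real.pi * s)) := by
      rw [mul_comm (Real.Gamma s), ← div_div, ← h, mul_div_cancel_left₀ _ h1]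
    rw [h2, inv_div]

/-- Hankel-type representation: the weight `α θ M_α(θ)` of the resolvent family is the imaginary
part of a contour integral. -/
theorem mul_wrightM_eq {α δ : ℝ} (hα : 0 < α) (hα1 : α < 1) (hδ0 : Real.pi / 2 < δ)
    (hδ : δ < Real.pi) {θ : ℝ} (hθ : 0 ≤ θ) :
    α * θ * wrightM α θ = Real.pi⁻¹ * (wrightContour α δ θ 0).im := by
  have h := Complex.hasSum_im (hasSum_wrightContour_zero hα hα1 hδ0 hδ hθ)
  -- the term `n = 0` is real, and dropping it absorbs the factor `θ` in front of the series
  rw [← hasSum_nat_add_iff' 1] at h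
  have h0 : (wrightContour α δ θ 0).im - ∑ i ∈ Finset.range 1,
      ((((-θ) ^ i / i.factorial : ℝ) : ℂ) *
      (Complex.exp ((Real.pi * (α * i + 1) : ℝ) * Complex.I) * Real.Gamma (α * i + 1))).im =
      (wrightContour α δ θ 0).im := by
    simp [Complex.exp_pi_mul_I]
  rw [h0] at h
  rw [wrightM, ← tsum_mul_left, ← (h.mul_left Real.pi⁻¹).tsum_eq]
  refine tsum_congr fun n => ?_
  have hs : 0 < α * ((n : ℝ) + 1) := by positivity
  rw [Complex.im_ofReal_mul, Complex.im_mul_ofReal, Complex.exp_ofReal_mul_I_im]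
  push_cast
  rw [Real.Gamma_add_one hs.ne', mul_add_one Real.pi, Real.sin_add_pi, ← div_div,
    div_eq_mul_inv _ (Real.Gamma _), inv_Gamma_one_sub hs, Nat.factorial_succ]
  have := Real.pi_pos.ne'
  have : (n.factorial : ℝ) ≠ 0 := by positivity
  push_cast
  field_simp
  ring

/-- The direction `δ = π / (1 + α)` of the contour: it points into the left half-plane, where
`exp σ` decays, while `σ ^ α` stays in the right half-plane. -/
theorem exists_contour_angle {α : ℝ} (hα : 0 < α) (hα1 : α < 1) :
    ∃ δ, Real.pi / 2 < δ ∧ δ < Real.pi ∧ α * δ < Real.pi / 2 := by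
  have hπ := Real.pi_pos
  have hδ0 : Real.pi / 2 < Real.pi / (1 + α) := by gcongr; linarith
  refine ⟨Real.pi / (1 + α), hδ0, ?_, ?_⟩
  · rw [div_lt_iff₀ (by linarith)]; nlinarith
  · have : α * (Real.pi / (1 + α)) = Real.pi - Real.pi / (1 + α) := by field_simp; ring
    linarith

/-- Superexponential decay: the bound at base point `k` of the contour is
`O(exp (-c k ^ α θ))`, and `k` is arbitrary. -/
theorem exists_abs_mul_wrightM_le {α : ℝ} (hα : 0 < α) (hα1 : α < 1) (κ : ℝ) :
    ∃ C, ∀ θ, 0 ≤ θ → |α * θ * wrightM α θ| ≤ C * Real.exp (-κ * θ) := by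
  have hπ := Real.pi_pos
  obtain ⟨δ, hδ0, hδ, hαδ⟩ := exists_contour_angle hα hα1
  have hs := Real.sin_pos_of_pos_of_lt_pi (by linarith) hδ
  have hδp : 0 < δ := by linarith
  have hc : 0 < Real.cos (α * δ) :=
    Real.cos_pos_of_mem_Ioo ⟨by linarith [mul_pos hα hδp], hαδ⟩
  have hlim : Tendsto (fun k : ℝ => (k * Real.sin δ) ^ α * Real.cos (α * δ)) atTop atTop :=
    ((tendsto_rpow_atTop hα).comp (tendsto_id.atTop_mul_const hs)).atTop_mul_const hc
  obtain ⟨k, hk1, hk⟩ := ((hlim.eventually_ge_atTop κ).and (eventually_gt_atTop 0)).exists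
  refine ⟨Real.pi⁻¹ * (Real.exp k * (-Real.cos δ)⁻¹), fun θ hθ => ?_⟩
  rw [mul_wrightM_eq hα hα1 hδ0 hδ hθ, ← wrightContour_im_eq hα hα1 hδ0 hδ hαδ hθ hk, abs_mul,
    abs_of_pos (by positivity : 0 < Real.pi⁻¹), mul_assoc Real.pi⁻¹]
  have h2 : 0 < -Real.cos δ := by
    linarith [Real.cos_neg_of_pi_div_two_lt_of_lt hδ0 (by linarith)]
  refine mul_le_mul_of_nonneg_left ?_ (by positivity)
  refine (Complex.abs_im_le_norm _).trans
    ((norm_wrightContour_le hα hδ0 hδ hαδ hθ hk.le).trans ?_)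
  rw [mul_right_comm, ← Real.exp_add]
  gcongr
  nlinarith

theorem continuousOn_mul_wrightM {α : ℝ} (hα : 0 < α) (hα1 : α < 1) :
    ContinuousOn (fun θ => α * θ * wrightM α θ) (Ici 0) := by
  have hπ := Real.pi_pos
  obtain ⟨δ, hδ0, hδ, hαδ⟩ := exists_contour_angle hα hα1
  have hδp : 0 < δ := by linarith
  have hs := Real.sin_pos_of_pos_of_lt_pi hδp hδ
  have hc : Real.cos δ < 0 := Real.cos_neg_of_pi_div_two_lt_of_lt hδ0 (by linarith)
  have h : ContinuousOn (fun θ => wrightContour α δ θ 0) (Ici 0) := by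
    refine continuousOn_of_dominated
      (bound := fun r => Real.exp 0 * Real.exp (Real.cos δ * r))
      (fun θ _ => (aestronglyMeasurable_wrightInt α θ 0 δ hs).mul_const _) ?_
      ((integrableOn_exp_mul_Ioi hc 0).const_mul _) ?_
    · intro θ hθ
      filter_upwards [ae_restrict_mem measurableSet_Ioi] with r hr
      rw [norm_mul, Complex.norm_exp_ofReal_mul_I, mul_one]
      exact norm_wrightInt_rayPt_le' hα hδp hδ hαδ le_rfl (le_of_lt hr) hθ
    · refine Eventually.of_forall fun r => Continuous.continuousOn ?_
      unfold wrightInt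
      fun_prop
  refine ((Complex.continuous_im.comp_continuousOn h).const_smul Real.pi⁻¹).congr fun θ hθ => ?_
  exact mul_wrightM_eq hα hα1 hδ0 hδ hθ

section semigroup

variable {X : Type*} [NormedAddCommGroup X] [NormedSpace ℝ X]

/-! ### Strongly continuous operator families -/

theorem exists_norm_le_of_continuous [CompleteSpace X] {Q : ℝ → X →L[ℝ] X}
    (hQ : ∀ x, Continuous fun t => Q t x) {K : Set ℝ} (hK : IsCompact K) :
    ∃ C, 0 ≤ C ∧ ∀ t ∈ K, ‖Q t‖ ≤ C := by
  obtain ⟨C, hC⟩ := banach_steinhaus (g := fun t : K => Q t) fun x => by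
    obtain ⟨C, hC⟩ := hK.exists_bound_of_continuousOn (hQ x).continuousOn
    exact ⟨C, fun t => hC t t.2⟩
  exact ⟨max C 0, le_max_right _ _, fun t ht => (hC ⟨t, ht⟩).trans (le_max_left _ _)⟩

/-- Over a Banach space, strong continuity of a family of bounded operators implies joint
continuity, by local uniform boundedness. -/
theorem continuous_uncurry_of_continuous [CompleteSpace X] {Q : ℝ → X →L[ℝ] X}
    (hQ : ∀ x, Continuous fun t => Q t x) : Continuous fun p : ℝ × X => Q p.1 p.2 := by
  rw [continuous_iff_continuousAt]
  rintro ⟨t, x⟩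
  obtain ⟨C, -, hC⟩ := exists_norm_le_of_continuous hQ (isCompact_Icc (a := t - 1) (b := t + 1))
  have h1 : Tendsto (fun p : ℝ × X => C * ‖p.2 - x‖ + ‖Q p.1 x - Q t x‖) (𝓝 (t, x)) (𝓝 0) := by
    have : Continuous fun p : ℝ × X => C * ‖p.2 - x‖ + ‖Q p.1 x - Q t x‖ := by
      have := (hQ x).comp (continuous_fst (X := ℝ) (Y := X))
      simp only [Function.comp_def] at this
      fun_prop
    simpa using this.tendsto (t, x)
  rw [ContinuousAt, tendsto_iff_norm_sub_tendsto_zero]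
  refine squeeze_zero' (Eventually.of_forall fun _ => norm_nonneg _) ?_ h1
  have hn : ∀ᶠ p : ℝ × X in 𝓝 (t, x), p.1 ∈ Icc (t - 1) (t + 1) :=
    (continuous_fst.tendsto (t, x)).eventually (Icc_mem_nhds (by simp) (by simp))
  filter_upwards [hn] with p hp
  calc ‖Q p.1 p.2 - Q t x‖ = ‖Q p.1 (p.2 - x) + (Q p.1 x - Q t x)‖ := by
        rw [map_sub]; congr 1; abel
    _ ≤ ‖Q p.1 (p.2 - x)‖ + ‖Q p.1 x - Q t x‖ := norm_add_le _ _
    _ ≤ _ := by gcongr; exact (Q p.1).le_of_opNorm_le (hC _ hp) _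

/-! ### Strongly continuous semigroups -/

/-- Otherwise some `tₙ → 0+` has `‖T tₙ‖ → ∞`, against the uniform boundedness principle. -/
theorem IsC0Semigroup.exists_norm_le_near_zero [CompleteSpace X] {T : ℝ → X →L[ℝ] X}
    (hT : IsC0Semigroup T) : ∃ ε > 0, ∃ M, 1 ≤ M ∧ ∀ t ∈ Icc 0 ε, ‖T t‖ ≤ M := by
  by_contra! h
  have h' : ∀ n : ℕ, ∃ t ∈ Icc (0 : ℝ) (1 / ((n : ℝ) + 1)), (n : ℝ) + 1 < ‖T t‖ := fun n =>
    h _ (by positivity) ((n : ℝ) + 1) (by linarith [Nat.cast_nonneg (α := ℝ) n])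
  choose t ht hn using h'
  have hpos : ∀ n, 0 < t n := fun n => by
    refine (ht n).1.lt_of_ne fun h0 => ?_
    have h1 := hn n
    rw [← h0, hT.map_zero] at h1
    have := ContinuousLinearMap.norm_id_le (𝕜 := ℝ) (E := X)
    linarith [Nat.cast_nonneg (α := ℝ) n]
  have hlim : Tendsto t atTop (𝓝[>] 0) :=
    tendsto_nhdsWithin_iff.2 ⟨squeeze_zero (fun n => (ht n).1) (fun n => (ht n).2)
      tendsto_one_div_add_atTop_nhds_zero_nat, Eventually.of_forall hpos⟩
  obtain ⟨C, hC⟩ := banach_steinhaus (g := fun n => T (t n)) fun x => by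
    obtain ⟨C, hC⟩ := ((hT.strong_cont x).comp hlim).norm.bddAbove_range
    exact ⟨C, fun n => hC ⟨n, rfl⟩⟩
  obtain ⟨n, hnC⟩ := exists_nat_gt C
  linarith [hC n, hn n]

theorem IsC0Semigroup.exists_norm_le_exp [CompleteSpace X] {T : ℝ → X →L[ℝ] X}
    (hT : IsC0Semigroup T) :
    ∃ M w, 0 ≤ M ∧ 0 ≤ w ∧ ∀ t, 0 ≤ t → ‖T t‖ ≤ M * Real.exp (w * t) := by
  obtain ⟨ε, hε, M, hM, hb⟩ := hT.exists_norm_le_near_zero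
  have hstep : ∀ n : ℕ, ∀ t, 0 ≤ t → t ≤ (n + 1) * ε → ‖T t‖ ≤ M ^ (n + 1) := by
    intro n
    induction n with
    | zero => intro t h0 h1; simpa using hb t ⟨h0, by simpa using h1⟩
    | succ n ih =>
      intro t h0 h1
      rcases le_total t ε with h | h
      · exact (hb t ⟨h0, h⟩).trans (le_self_pow₀ hM (by simp))
      · have h2 : ‖T (t - ε)‖ ≤ M ^ (n + 1) := ih _ (by linarith) (by push_cast at h1; linarith)
        have h3 : T t = (T ε).comp (T (t - ε)) := by
          rw [← hT.map_add _ _ hε.le (by linarith), add_sub_cancel]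
        rw [h3, pow_succ' _ (n + 1)]
        refine (ContinuousLinearMap.opNorm_comp_le _ _).trans ?_
        exact mul_le_mul (hb ε ⟨hε.le, le_rfl⟩) h2 (norm_nonneg _) (by linarith)
  have hM0 : 0 < M := by linarith
  refine ⟨M, Real.log M / ε, by linarith, div_nonneg (Real.log_nonneg hM) hε.le, fun t ht => ?_⟩
  have hfl : (⌊t / ε⌋₊ : ℝ) ≤ t / ε := Nat.floor_le (by positivity)
  refine (hstep ⌊t / ε⌋₊ t ht ?_).trans ?_
  · rw [← div_le_iff₀ hε]
    exact (Nat.lt_floor_add_one _).le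
  · rw [pow_succ', ← Real.rpow_natCast, Real.rpow_def_of_pos hM0, div_mul_eq_mul_div, mul_div_assoc]
    have := Real.log_nonneg hM
    gcongr

/-- Orbits are continuous on `[0, ∞)`; composing with `max t 0` extends them to the line. -/
theorem IsC0Semigroup.continuous_max [CompleteSpace X] {T : ℝ → X →L[ℝ] X}
    (hT : IsC0Semigroup T) (x : X) : Continuous fun t => T (max t 0) x := by
  obtain ⟨M, w, hM, hw, hb⟩ := hT.exists_norm_le_exp
  suffices h : ContinuousOn (fun t => T t x) (Ici 0) from
    h.comp_continuous (by fun_prop) fun t => le_max_right t 0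
  have hT0 : Tendsto (fun t => T t x - x) (𝓝[≥] 0) (𝓝 0) := by
    rw [← sub_self x]
    refine Tendsto.sub_const ?_ x
    rw [← Ioi_insert, nhdsWithin_insert]
    refine Tendsto.sup (tendsto_pure_left.2 fun s hs => ?_) (hT.strong_cont x)
    rw [hT.map_zero]
    exact mem_of_mem_nhds hs
  have hle : ∀ s t, 0 ≤ s → s ≤ t →
      ‖T t x - T s x‖ ≤ M * Real.exp (w * t) * ‖T (t - s) x - x‖ := by
    intro s t hs hst
    have h1 : T t x = T s (T (t - s) x) := by
      have := hT.map_add s (t - s) hs (by linarith)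
      rw [add_sub_cancel] at this
      rw [this]; rfl
    rw [h1, ← map_sub]
    refine (T s).le_of_opNorm_le ((hb s hs).trans ?_) _
    gcongr
  intro t ht
  rw [ContinuousWithinAt, tendsto_iff_norm_sub_tendsto_zero]
  have habs : Tendsto (fun s => |s - t|) (𝓝[Ici 0] t) (𝓝[≥] 0) := by
    refine tendsto_nhdsWithin_iff.2 ⟨?_, Eventually.of_forall fun s => abs_nonneg (s - t)⟩
    have : Continuous fun s => |s - t| := by fun_prop
    simpa using this.continuousWithinAt.tendsto (s := Ici 0) (x := t)
  have hexp : Tendsto (fun s => M * Real.exp (w * max s t)) (𝓝[Ici 0] t)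
      (𝓝 (M * Real.exp (w * max t t))) := by
    have : Continuous fun s => M * Real.exp (w * max s t) := by fun_prop
    exact this.continuousWithinAt.tendsto
  have hlim := hexp.mul (hT0.comp habs).norm
  rw [norm_zero, mul_zero] at hlim
  refine squeeze_zero' (Eventually.of_forall fun _ => norm_nonneg _) ?_ hlim
  filter_upwards [self_mem_nhdsWithin] with s hs
  rcases le_total s t with h | h
  · rw [norm_sub_rev, max_eq_right h, Function.comp_apply, abs_sub_comm,
      abs_of_nonneg (sub_nonneg.2 h)]
    exact hle s t hs h
  · rw [max_eq_left h, Function.comp_apply, abs_of_nonneg (sub_nonneg.2 h)]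
    exact hle t s ht h

/-! ### The subordinated family `P_α` -/

section subordination

variable [CompleteSpace X] {T : ℝ → X →L[ℝ] X} {α : ℝ}

theorem aestronglyMeasurable_opP_integrand (hT : IsC0Semigroup T) (hα : 0 < α) (hα1 : α < 1)
    {t : ℝ} (ht : 0 ≤ t) (x : X) :
    AEStronglyMeasurable (fun θ => (α * θ * wrightM α θ) • T (t ^ α * θ) x)
      (volume.restrict (Ioi 0)) := by
  have h1 : AEStronglyMeasurable (fun θ => α * θ * wrightM α θ) (volume.restrict (Ioi 0)) :=
    ((continuousOn_mul_wrightM hα hα1).mono Ioi_subset_Ici_self).aestronglyMeasurable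
      measurableSet_Ioi
  have h2 : Continuous fun θ => T (max (t ^ α * θ) 0) x :=
    (hT.continuous_max x).comp (by fun_prop : Continuous fun θ => t ^ α * θ)
  refine (h1.smul h2.aestronglyMeasurable).congr ?_
  filter_upwards [ae_restrict_mem measurableSet_Ioi] with θ hθ
  have : 0 ≤ t ^ α * θ := mul_nonneg (by positivity) (le_of_lt hθ)
  simp only [Pi.smul_apply', max_eq_left this]

/-- For `t ≤ R` the operators `T(t ^ α θ)` grow at most like `exp (w R ^ α θ)`, so the decay of the
Wright function at rate `w R ^ α + 1` leaves the factor `exp (-θ)`. -/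
theorem exists_norm_opP_integrand_le (hT : IsC0Semigroup T) (hα : 0 < α) (hα1 : α < 1) (R : ℝ) :
    ∃ C, 0 ≤ C ∧ ∀ t, 0 ≤ t → t ≤ R → ∀ θ, 0 < θ → ∀ x : X,
      ‖(α * θ * wrightM α θ) • T (t ^ α * θ) x‖ ≤ C * Real.exp (-1 * θ) * ‖x‖ := by
  obtain ⟨M, w, hM, hw, hb⟩ := hT.exists_norm_le_exp
  obtain ⟨C, hC⟩ := exists_abs_mul_wrightM_le hα hα1 (w * R ^ α + 1)
  have hC0 : 0 ≤ C := by
    have := (abs_nonneg _).trans (hC 0 le_rfl)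
    simpa using this
  refine ⟨C * M, by positivity, fun t ht htR θ hθ x => ?_⟩
  rw [norm_smul, Real.norm_eq_abs]
  have h0 : 0 ≤ t ^ α * θ := by positivity
  have h1 : ‖T (t ^ α * θ) x‖ ≤ M * Real.exp (w * (R ^ α * θ)) * ‖x‖ := by
    refine (T _).le_of_opNorm_le ((hb _ h0).trans ?_) x
    have : t ^ α ≤ R ^ α := Real.rpow_le_rpow ht htR hα.le
    gcongr
  calc _ ≤ (C * Real.exp (-(w * R ^ α + 1) * θ)) * (M * Real.exp (w * (R ^ α * θ)) * ‖x‖) :=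
        mul_le_mul (hC θ hθ.le) h1 (norm_nonneg _) (by positivity)
    _ = C * M * (Real.exp (-(w * R ^ α + 1) * θ) * Real.exp (w * (R ^ α * θ))) * ‖x‖ := by ring
    _ = _ := by rw [← Real.exp_add]; congr 3; ring

theorem integrableOn_opP_integrand (hT : IsC0Semigroup T) (hα : 0 < α) (hα1 : α < 1) {t : ℝ}
    (ht : 0 ≤ t) (x : X) :
    IntegrableOn (fun θ => (α * θ * wrightM α θ) • T (t ^ α * θ) x) (Ioi 0) := by
  obtain ⟨C, -, hC⟩ := exists_norm_opP_integrand_le hT hα hα1 t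
  refine Integrable.mono'
    (((integrableOn_exp_mul_Ioi (by norm_num : (-1 : ℝ) < 0) 0).const_mul C).mul_const ‖x‖)
    (aestronglyMeasurable_opP_integrand hT hα hα1 ht x) ?_
  filter_upwards [ae_restrict_mem measurableSet_Ioi] with θ hθ
  exact hC t ht le_rfl θ hθ x

theorem exists_norm_opP_le (hT : IsC0Semigroup T) (hα : 0 < α) (hα1 : α < 1) (t : ℝ)
    (ht : 0 ≤ t) : ∃ C, ∀ x : X, ‖opP α T t x‖ ≤ C * ‖x‖ := by
  obtain ⟨C, -, hC⟩ := exists_norm_opP_integrand_le hT hα hα1 t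
  refine ⟨∫ θ in Ioi (0 : ℝ), C * Real.exp (-1 * θ), fun x => ?_⟩
  rw [opP, if_neg hα1.ne, ← integral_mul_const]
  refine norm_integral_le_of_norm_le
    (((integrableOn_exp_mul_Ioi (by norm_num : (-1 : ℝ) < 0) 0).const_mul C).mul_const ‖x‖) ?_
  filter_upwards [ae_restrict_mem measurableSet_Ioi] with θ hθ
  exact hC t ht le_rfl θ hθ x

theorem continuousOn_opP (hT : IsC0Semigroup T) (hα : 0 < α) (hα1 : α < 1) (x : X) :
    ContinuousOn (fun t => opP α T t x) (Ici 0) := by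
  suffices h : ∀ R, ContinuousOn (fun t => opP α T t x) (Icc 0 R) by
    intro t ht
    refine (h (t + 1) t ⟨ht, by linarith⟩).mono_of_mem_nhdsWithin ?_
    rw [← Ici_inter_Iic]
    exact inter_mem_nhdsWithin _ (Iic_mem_nhds (by linarith))
  intro R
  obtain ⟨C, -, hC⟩ := exists_norm_opP_integrand_le hT hα hα1 R
  simp only [opP, if_neg hα1.ne]
  refine continuousOn_of_dominated (bound := fun θ => C * Real.exp (-1 * θ) * ‖x‖)
    (fun t ht => aestronglyMeasurable_opP_integrand hT hα hα1 ht.1 x) ?_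
    (((integrableOn_exp_mul_Ioi (by norm_num : (-1 : ℝ) < 0) 0).const_mul C).mul_const ‖x‖) ?_
  · intro t ht
    filter_upwards [ae_restrict_mem measurableSet_Ioi] with θ hθ
    exact hC t ht.1 ht.2 θ hθ x
  · filter_upwards [ae_restrict_mem measurableSet_Ioi] with θ hθ
    have hθ : 0 < θ := hθ
    have h1 : Continuous fun t : ℝ => T (max (t ^ α * θ) 0) x := by
      have := Real.continuous_rpow_const hα.le
      exact (hT.continuous_max x).comp (by fun_prop : Continuous fun t : ℝ => t ^ α * θ)
    refine (h1.const_smul (α * θ * wrightM α θ)).continuousOn.congr fun t ht => ?_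
    have := ht.1
    rw [Pi.smul_apply, max_eq_left (by positivity)]

/-- On `[0, ∞)` the operators `P_α(t)` are the values of a family of bounded operators that is
strongly continuous on the whole line. -/
theorem exists_clm_opP (hT : IsC0Semigroup T) (hα : 0 < α) (hα1 : α ≤ 1) :
    ∃ Q : ℝ → X →L[ℝ] X, (∀ x, Continuous fun t => Q t x) ∧
      ∀ t, 0 ≤ t → ∀ x, opP α T t x = Q t x := by
  rcases hα1.eq_or_lt with rfl | hα1
  · exact ⟨fun t => T (max t 0), hT.continuous_max, fun t ht x => by simp [opP, max_eq_left ht]⟩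
  have hadd : ∀ t, 0 ≤ t → ∀ x y, opP α T t (x + y) = opP α T t x + opP α T t y := by
    intro t ht x y
    simp only [opP, if_neg hα1.ne, map_add, smul_add]
    exact integral_add (integrableOn_opP_integrand hT hα hα1 ht x)
      (integrableOn_opP_integrand hT hα hα1 ht y)
  have hsmul : ∀ t (c : ℝ) x, opP α T t (c • x) = c • opP α T t x := by
    intro t c x
    simp only [opP, if_neg hα1.ne, map_smul]
    rw [← integral_smul]
    exact integral_congr_ae (Eventually.of_forall fun θ => smul_comm _ _ _)
  refine ⟨fun t => LinearMap.mkContinuousOfExistsBound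
    { toFun := opP α T (max t 0)
      map_add' := hadd _ (le_max_right _ _)
      map_smul' := hsmul _ } (exists_norm_opP_le hT hα hα1 _ (le_max_right _ _)), fun x => ?_,
    fun t ht x => ?_⟩
  · exact (continuousOn_opP hT hα hα1 x).comp_continuous
      (by fun_prop : Continuous fun t : ℝ => max t 0) fun t => le_max_right t 0
  · change _ = opP α T (max t 0) x
    rw [max_eq_left ht]

end subordination

end semigroup

section stateEquation

variable {X Y : Type*} [NormedAddCommGroup X] [NormedSpace ℝ X]
  [NormedAddCommGroup Y] [InnerProductSpace ℝ Y]

/-! ### The time change `ψ` -/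

/-- The regularity of `ψ` used below: `ψ` is differentiable on `[a, b]` with continuous
nonnegative derivative bounded by `D`, and increases with slope at least `c > 0`. -/
structure IsTimeChange (a b : ℝ) (ψ : ℝ → ℝ) (c D : ℝ) : Prop where
  pos : 0 < c
  hasDeriv : ∀ s ∈ Icc a b, HasDerivWithinAt ψ (dpsi a b ψ s) (Icc a b) s
  continuousOn_dpsi : ContinuousOn (dpsi a b ψ) (Icc a b)
  dpsi_nonneg : ∀ s ∈ Icc a b, 0 ≤ dpsi a b ψ s
  dpsi_le : ∀ s ∈ Icc a b, dpsi a b ψ s ≤ D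
  mul_sub_le : ∀ s t, a ≤ s → s ≤ t → t ≤ b → c * (t - s) ≤ ψ t - ψ s

theorem exists_isTimeChange {a b : ℝ} (hab : a < b) {ψ : ℝ → ℝ} (hψ : ContDiffOn ℝ 1 ψ (Icc a b))
    (hmono : MonotoneOn ψ (Icc a b)) (hψ' : ∀ t ∈ Icc a b, derivWithin ψ (Icc a b) t ≠ 0) :
    ∃ c D, IsTimeChange a b ψ c D := by
  have hd : ContinuousOn (dpsi a b ψ) (Icc a b) :=
    hψ.continuousOn_derivWithin (uniqueDiffOn_Icc hab) le_rfl
  have hder : ∀ s ∈ Icc a b, HasDerivWithinAt ψ (dpsi a b ψ s) (Icc a b) s := fun s hs =>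
    (hψ.differentiableOn one_ne_zero s hs).hasDerivWithinAt
  have hpos : ∀ s ∈ Icc a b, 0 < dpsi a b ψ s := fun s hs =>
    (hmono.derivWithin_nonneg).lt_of_ne (hψ' s hs).symm
  obtain ⟨m, hm, hmin⟩ := isCompact_Icc.exists_isMinOn (nonempty_Icc.2 hab.le) hd
  obtain ⟨D, hD⟩ := isCompact_Icc.exists_bound_of_continuousOn hd
  refine ⟨dpsi a b ψ m, D, hpos m hm, hder, hd, fun s hs => (hpos s hs).le,
    fun s hs => (le_abs_self _).trans (hD s hs), fun s t has hst htb => ?_⟩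
  refine (convex_Icc a b).mul_sub_le_image_sub_of_le_deriv hψ.continuousOn
    ((hψ.differentiableOn one_ne_zero).mono interior_subset) ?_ s ⟨has, hst.trans htb⟩ t
    ⟨has.trans hst, htb⟩ hst
  intro x hx
  rw [← derivWithin_of_mem_nhds (mem_interior_iff_mem_nhds.1 hx)]
  exact hmin (interior_subset hx)

namespace IsTimeChange

variable {a b c D : ℝ} {ψ : ℝ → ℝ}

theorem continuousOn (h : IsTimeChange a b ψ c D) : ContinuousOn ψ (Icc a b) :=
  fun s hs => (h.hasDeriv s hs).continuousWithinAt

theorem strictMonoOn (h : IsTimeChange a b ψ c D) : StrictMonoOn ψ (Icc a b) := by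
  intro s hs t ht hst
  have := h.mul_sub_le s t hs.1 hst.le ht.2
  have := mul_pos h.pos (sub_pos.2 hst)
  linarith

end IsTimeChange

/-! ### Weakly singular kernels -/

/-- The power `τ ^ (α - 1)` cut off outside `(0, ε]`. -/
noncomputable def truncPow (α ε τ : ℝ) : ℝ := (Ioc 0 ε).indicator (fun τ => τ ^ (α - 1)) τ

theorem truncPow_nonneg (α ε τ : ℝ) : 0 ≤ truncPow α ε τ :=
  indicator_nonneg (fun _ hτ => Real.rpow_nonneg hτ.1.le _) τ

theorem measurable_truncPow (α ε : ℝ) : Measurable (truncPow α ε) :=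
  (measurable_id.pow_const (α - 1)).indicator measurableSet_Ioc

theorem truncPow_sq (α ε τ : ℝ) :
    truncPow α ε τ ^ 2 = (Ioc 0 ε).indicator (fun τ => τ ^ (2 * α - 2)) τ := by
  unfold truncPow
  by_cases h : τ ∈ Ioc 0 ε
  · rw [indicator_of_mem h, indicator_of_mem h, ← Real.rpow_mul_natCast h.1.le]
    congr 1
    push_cast
    ring
  · simp [indicator_of_notMem h]

theorem integral_truncPow_sq {α ε : ℝ} (hα : 1 / 2 < α) (hε : 0 ≤ ε) :
    Integrable (fun τ => truncPow α ε τ ^ 2) ∧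
      ∫ τ, truncPow α ε τ ^ 2 = ε ^ (2 * α - 1) / (2 * α - 1) := by
  simp_rw [truncPow_sq]
  rw [integrable_indicator_iff measurableSet_Ioc, integral_indicator measurableSet_Ioc,
    ← intervalIntegral.integral_of_le hε, ← intervalIntegrable_iff_integrableOn_Ioc_of_le hε,
    integral_rpow (Or.inl (by linarith)), show 2 * α - 2 + 1 = 2 * α - 1 by ring,
    Real.zero_rpow (by linarith), sub_zero]
  exact ⟨intervalIntegral.intervalIntegrable_rpow' (by linarith), rfl⟩

theorem Control.integral_norm_sq {a b : ℝ} (u : Control Y a b) :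
    ∫ s, ‖u s‖ ^ 2 ∂(volume.restrict (Icc a b)) = ‖u‖ ^ 2 := by
  rw [← real_inner_self_eq_norm_sq, L2.inner_def]
  simp_rw [real_inner_self_eq_norm_sq]

/-- The Cauchy-Schwarz bound that makes the Volterra integral converge for square integrable
controls; it needs `α > 1 / 2`. The constant is uniform in `t` and vanishes with `ε`. -/
theorem integral_truncPow_mul_norm_le {a b α ε : ℝ} (hα : 1 / 2 < α) (hε : 0 ≤ ε) (t : ℝ)
    (u : Control Y a b) :
    Integrable (fun s => truncPow α ε (t - s) * ‖u s‖) (volume.restrict (Icc a b)) ∧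
    ∫ s, truncPow α ε (t - s) * ‖u s‖ ∂(volume.restrict (Icc a b)) ≤
      √(ε ^ (2 * α - 1) / (2 * α - 1)) * ‖u‖ := by
  obtain ⟨hi, hv⟩ := integral_truncPow_sq hα hε
  have hi' := hi.comp_sub_left t
  have hv' := integral_sub_left_eq_self (fun τ => truncPow α ε τ ^ 2) volume t
  have hm : Measurable fun s => truncPow α ε (t - s) :=
    (measurable_truncPow α ε).comp (measurable_const.sub measurable_id)
  have hg : MemLp (fun s => truncPow α ε (t - s)) 2 (volume.restrict (Icc a b)) :=
    (memLp_two_iff_integrable_sq hm.aestronglyMeasurable).2 hi'.integrableOn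
  have hu : MemLp (fun s => ‖u s‖) 2 (volume.restrict (Icc a b)) := (Lp.memLp u).norm
  refine ⟨hg.integrable_mul hu, ?_⟩
  have h2 : ENNReal.ofReal 2 = 2 := by simp
  refine (integral_mul_le_Lp_mul_Lq_of_nonneg Real.HolderConjugate.two_two
    (Eventually.of_forall fun s => truncPow_nonneg α ε (t - s))
    (Eventually.of_forall fun s => norm_nonneg (u s)) (by rwa [h2]) (by rwa [h2])).trans ?_
  simp only [Real.rpow_two]
  rw [Control.integral_norm_sq, ← Real.sqrt_eq_rpow, ← Real.sqrt_eq_rpow,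
    Real.sqrt_sq (norm_nonneg _), ← hv, ← hv']
  refine mul_le_mul_of_nonneg_right (Real.sqrt_le_sqrt ?_) (norm_nonneg u)
  exact setIntegral_le_integral hi' (Eventually.of_forall fun s => sq_nonneg _)

/-- The kernel `ψ'(s) (ψ(t) - ψ(s))^(α - 1) Q(ψ(t) - ψ(s))`. -/
noncomputable def volterraKer (a b : ℝ) (ψ : ℝ → ℝ) (α : ℝ) (Q : ℝ → X →L[ℝ] X) (t s : ℝ)
    (x : X) : X :=
  (dpsi a b ψ s * (ψ t - ψ s) ^ (α - 1)) • Q (ψ t - ψ s) x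

section volterra

variable {a b c D α : ℝ} {ψ : ℝ → ℝ} {Q : ℝ → X →L[ℝ] X}

theorem continuousWithinAt_volterraKer (hψ : IsTimeChange a b ψ c D)
    (hQ : ∀ x, Continuous fun t => Q t x) {s t : ℝ} (hs : a ≤ s) (hst : s < t) (ht : t ≤ b)
    (x : X) :
    ContinuousWithinAt (fun t => volterraKer a b ψ α Q t s x) (Icc a b) t := by
  have h1 : ContinuousWithinAt (fun t => ψ t - ψ s) (Icc a b) t :=
    (hψ.continuousOn t ⟨hs.trans hst.le, ht⟩).sub continuousWithinAt_const
  have h0 : 0 < ψ t - ψ s :=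
    sub_pos.2 (hψ.strictMonoOn ⟨hs, hst.le.trans ht⟩ ⟨hs.trans hst.le, ht⟩ hst)
  exact (continuousWithinAt_const.mul (h1.rpow_const (Or.inl h0.ne'))).smul
    ((hQ x).continuousAt.comp_continuousWithinAt h1)

/-- The Volterra integral with the part of the kernel at distance less than `ε` from the
singularity removed; `ε = 0` gives the whole Volterra integral. -/
noncomputable def truncVolterra (a b : ℝ) (ψ : ℝ → ℝ) (α : ℝ) (Q : ℝ → X →L[ℝ] X) (B : Y →L[ℝ] X)
    (u : Control Y a b) (ε t : ℝ) : X :=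
  ∫ s in Icc a b, (Iio (t - ε)).indicator (fun s => volterraKer a b ψ α Q t s (B (u s))) s

theorem truncVolterra_zero_eq (B : Y →L[ℝ] X) (u : Control Y a b) {t : ℝ} (ht : t ∈ Icc a b) :
    truncVolterra a b ψ α Q B u 0 t =
      ∫ s in Icc a b, (Ico (t - (b - a)) t).indicator
        (fun s => volterraKer a b ψ α Q t s (B (u s))) s := by
  rw [truncVolterra, sub_zero]
  refine setIntegral_congr_fun measurableSet_Icc fun s hs => ?_
  have : s ∈ Iio t ↔ s ∈ Ico (t - (b - a)) t :=
    ⟨fun h => ⟨by linarith [ht.2, hs.1], h⟩, fun h => h.2⟩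
  simp only [indicator, this]

theorem truncVolterra_zero_eq_intervalIntegral (B : Y →L[ℝ] X) (u : Control Y a b) {t : ℝ}
    (ht : t ∈ Icc a b) :
    truncVolterra a b ψ α Q B u 0 t = ∫ s in a..t, volterraKer a b ψ α Q t s (B (u s)) := by
  rw [truncVolterra, sub_zero, setIntegral_indicator measurableSet_Iio,
    intervalIntegral.integral_of_le ht.1, ← integral_Ico_eq_integral_Ioc]
  congr 2
  ext s
  simp only [mem_inter_iff, mem_Icc, mem_Iio, mem_Ico]
  exact ⟨fun h => ⟨h.1.1, h.2⟩, fun h => ⟨⟨h.1, h.2.le.trans ht.2⟩, h.2⟩⟩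

variable [CompleteSpace X]

theorem exists_norm_volterraKer_le (hψ : IsTimeChange a b ψ c D) (hα1 : α ≤ 1)
    (hQ : ∀ x, Continuous fun t => Q t x) :
    ∃ E, 0 ≤ E ∧ ∀ s t, a ≤ s → s < t → t ≤ b → ∀ x,
      ‖volterraKer a b ψ α Q t s x‖ ≤ E * (t - s) ^ (α - 1) * ‖x‖ := by
  obtain ⟨C, hC0, hC⟩ := exists_norm_le_of_continuous hQ (isCompact_Icc (a := 0) (b := ψ b - ψ a))
  refine ⟨max D 0 * c ^ (α - 1) * C, by have := hψ.pos; positivity,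
    fun s t has hst htb x => ?_⟩
  have hc := hψ.pos
  have hts : 0 < t - s := sub_pos.2 hst
  have hs : s ∈ Icc a b := ⟨has, hst.le.trans htb⟩
  have ht : t ∈ Icc a b := ⟨has.trans hst.le, htb⟩
  have hmono := hψ.strictMonoOn.monotoneOn
  have h1 := hψ.mul_sub_le s t has hst.le htb
  have h0 : 0 ≤ ψ t - ψ s := le_trans (by positivity) h1
  have hmem : ψ t - ψ s ∈ Icc 0 (ψ b - ψ a) := ⟨h0, by
    linarith [hmono ht (right_mem_Icc.2 (ht.1.trans ht.2)) htb,
      hmono (left_mem_Icc.2 (ht.1.trans ht.2)) hs has]⟩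
  have h2 : (ψ t - ψ s) ^ (α - 1) ≤ c ^ (α - 1) * (t - s) ^ (α - 1) := by
    rw [← Real.mul_rpow hc.le hts.le]
    exact Real.rpow_le_rpow_of_nonpos (by positivity) h1 (by linarith)
  rw [volterraKer, norm_smul, norm_mul, Real.norm_of_nonneg (hψ.dpsi_nonneg s hs),
    Real.norm_of_nonneg (by positivity)]
  have h3 : dpsi a b ψ s ≤ max D 0 := (hψ.dpsi_le s hs).trans (le_max_left _ _)
  calc _ ≤ (max D 0 * (c ^ (α - 1) * (t - s) ^ (α - 1))) * (C * ‖x‖) := by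
        refine mul_le_mul (mul_le_mul h3 h2 (by positivity) (by positivity))
          ((Q _).le_of_opNorm_le (hC _ hmem) x) (norm_nonneg _) (by positivity)
    _ = _ := by ring

theorem aestronglyMeasurable_volterraKer (hψ : IsTimeChange a b ψ c D)
    (hQ : ∀ x, Continuous fun t => Q t x) (t : ℝ) {w : ℝ → X}
    (hw : AEStronglyMeasurable w (volume.restrict (Icc a b))) :
    AEStronglyMeasurable (fun s => volterraKer a b ψ α Q t s (w s))
      (volume.restrict (Icc a b)) := by
  have h1 : AEStronglyMeasurable (fun s => ψ t - ψ s) (volume.restrict (Icc a b)) :=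
    (continuousOn_const.sub hψ.continuousOn).aestronglyMeasurable measurableSet_Icc
  have h2 := (continuous_uncurry_of_continuous hQ).comp_aestronglyMeasurable (h1.prodMk hw)
  have h3 := hψ.continuousOn_dpsi.aestronglyMeasurable (μ := volume) measurableSet_Icc
  exact (h3.mul (h1.aemeasurable.pow_const (α - 1)).aestronglyMeasurable).smul h2

theorem aestronglyMeasurable_volterraKer_control (hψ : IsTimeChange a b ψ c D)
    (hQ : ∀ x, Continuous fun t => Q t x) (B : Y →L[ℝ] X) (u : Control Y a b) (t : ℝ) :
    AEStronglyMeasurable (fun s => volterraKer a b ψ α Q t s (B (u s)))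
      (volume.restrict (Icc a b)) :=
  aestronglyMeasurable_volterraKer hψ hQ t
    (B.continuous.comp_aestronglyMeasurable (Lp.aestronglyMeasurable u))

theorem continuousOn_truncVolterra (hψ : IsTimeChange a b ψ c D) (hα1 : α ≤ 1)
    (hQ : ∀ x, Continuous fun t => Q t x) (B : Y →L[ℝ] X) (u : Control Y a b) {ε : ℝ}
    (hε : 0 < ε) : ContinuousOn (truncVolterra a b ψ α Q B u ε) (Icc a b) := by
  obtain ⟨E, hE0, hE⟩ := exists_norm_volterraKer_le (α := α) hψ hα1 hQ
  intro t₀ ht₀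
  have hu : Integrable (fun s => ‖u s‖) (volume.restrict (Icc a b)) :=
    ((Lp.memLp u).integrable (by norm_num)).norm
  refine continuousWithinAt_of_dominated
    (bound := fun s => E * ε ^ (α - 1) * ‖B‖ * ‖u s‖) ?_ ?_ (hu.const_mul _) ?_
  · exact Eventually.of_forall fun t =>
      (aestronglyMeasurable_volterraKer_control hψ hQ B u t).indicator measurableSet_Iio
  · filter_upwards [self_mem_nhdsWithin] with t ht
    filter_upwards [ae_restrict_mem measurableSet_Icc] with s hs
    by_cases h : s ∈ Iio (t - ε)
    · have h : s < t - ε := h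
      rw [indicator_of_mem (mem_Iio.2 h)]
      refine (hE s t hs.1 (by linarith) ht.2 _).trans ?_
      have h1 : (t - s) ^ (α - 1) ≤ ε ^ (α - 1) :=
        Real.rpow_le_rpow_of_nonpos hε (by linarith) (by linarith)
      rw [mul_assoc _ ‖B‖]
      have := B.le_opNorm (u s)
      gcongr
    · rw [indicator_of_notMem h, norm_zero]
      positivity
  -- the cut-off is continuous at `t₀` for every `s` except `s = t₀ - ε`
  · have hne : ∀ᵐ s ∂(volume.restrict (Icc a b)), s ≠ t₀ - ε :=
      ae_restrict_of_ae (by simp [ae_iff, measure_singleton])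
    filter_upwards [hne, ae_restrict_mem measurableSet_Icc] with s hs hsI
    have hct : Tendsto (fun t : ℝ => t - ε) (𝓝[Icc a b] t₀) (𝓝 (t₀ - ε)) :=
      (continuous_sub_right ε).continuousWithinAt.tendsto
    rcases hs.lt_or_gt with h | h
    · refine (continuousWithinAt_volterraKer (α := α) hψ hQ hsI.1 (by linarith) ht₀.2
        (B (u s))).congr_of_eventuallyEq ?_ (indicator_of_mem (mem_Iio.2 h) _)
      filter_upwards [hct.eventually_const_lt h] with t ht
      exact indicator_of_mem (mem_Iio.2 ht) _
    · refine (continuousWithinAt_const (b := (0 : X))).congr_of_eventuallyEq ?_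
        (indicator_of_notMem (by simpa using h.le) _)
      filter_upwards [hct.eventually_lt_const h] with t ht
      exact indicator_of_notMem (by simpa using ht.le) _

/-- The part of the Volterra integral at distance at most `ε` from the singularity, bounded
uniformly in `t`: small `ε` gives uniform convergence of the truncations, `ε = b - a` boundedness
of the whole integral. -/
theorem exists_norm_volterra_slice_le (hψ : IsTimeChange a b ψ c D) (hα : 1 / 2 < α) (hα1 : α ≤ 1)
    (hQ : ∀ x, Continuous fun t => Q t x) (B : Y →L[ℝ] X) :
    ∃ E, 0 ≤ E ∧ ∀ (u : Control Y a b), ∀ t ∈ Icc a b, ∀ ε, 0 ≤ ε →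
      IntegrableOn ((Ico (t - ε) t).indicator fun s => volterraKer a b ψ α Q t s (B (u s)))
        (Icc a b) ∧
      ‖∫ s in Icc a b, (Ico (t - ε) t).indicator
        (fun s => volterraKer a b ψ α Q t s (B (u s))) s‖ ≤
        E * √(ε ^ (2 * α - 1) / (2 * α - 1)) * ‖u‖ := by
  obtain ⟨E, hE0, hE⟩ := exists_norm_volterraKer_le (α := α) hψ hα1 hQ
  refine ⟨E * ‖B‖, by positivity, fun u t ht ε hε => ?_⟩
  obtain ⟨hi, hle⟩ := integral_truncPow_mul_norm_le hα hε t u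
  have hb : ∀ᵐ s ∂(volume.restrict (Icc a b)), ‖(Ico (t - ε) t).indicator
      (fun s => volterraKer a b ψ α Q t s (B (u s))) s‖ ≤
      E * ‖B‖ * (truncPow α ε (t - s) * ‖u s‖) := by
    filter_upwards [ae_restrict_mem measurableSet_Icc] with s hs
    by_cases h : s ∈ Ico (t - ε) t
    · rw [indicator_of_mem h, truncPow,
        indicator_of_mem (show t - s ∈ Ioc 0 ε from ⟨by linarith [h.2], by linarith [h.1]⟩)]
      refine (hE s t hs.1 h.2 ht.2 _).trans ?_
      have h1 : 0 ≤ (t - s) ^ (α - 1) := Real.rpow_nonneg (by linarith [h.2]) _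
      calc _ ≤ E * (t - s) ^ (α - 1) * (‖B‖ * ‖u s‖) := by gcongr; exact B.le_opNorm _
        _ = _ := by ring
    · rw [indicator_of_notMem h, norm_zero]
      have := truncPow_nonneg α ε (t - s)
      positivity
  refine ⟨Integrable.mono' (hi.const_mul _)
    ((aestronglyMeasurable_volterraKer_control hψ hQ B u t).indicator measurableSet_Ico) hb, ?_⟩
  refine (norm_integral_le_of_norm_le (hi.const_mul _) hb).trans ?_
  rw [integral_const_mul, mul_assoc (E * ‖B‖)]
  gcongr

/-- The Volterra integral is continuous up to both end points, as the uniform limit of its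
truncations. -/
theorem continuousOn_volterra (hψ : IsTimeChange a b ψ c D) (hα : 1 / 2 < α) (hα1 : α ≤ 1)
    (hQ : ∀ x, Continuous fun t => Q t x) (B : Y →L[ℝ] X) (u : Control Y a b) :
    ContinuousOn (truncVolterra a b ψ α Q B u 0) (Icc a b) := by
  obtain ⟨E, hE0, hE⟩ := exists_norm_volterra_slice_le hψ hα hα1 hQ B
  have hdiff : ∀ ε, 0 < ε → ∀ t ∈ Icc a b,
      ‖truncVolterra a b ψ α Q B u 0 t - truncVolterra a b ψ α Q B u ε t‖ ≤
        E * √(ε ^ (2 * α - 1) / (2 * α - 1)) * ‖u‖ := by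
    intro ε hε t ht
    have hab : a ≤ b := ht.1.trans ht.2
    refine le_trans (le_of_eq ?_) (hE u t ht ε hε.le).2
    have hfull := (hE u t ht (b - a) (by linarith)).1
    have hslice := (hE u t ht ε hε.le).1
    have hsplit : ∀ s ∈ Icc a b, (Iio (t - ε)).indicator
        (fun s => volterraKer a b ψ α Q t s (B (u s))) s =
        (Ico (t - (b - a)) t).indicator (fun s => volterraKer a b ψ α Q t s (B (u s))) s -
        (Ico (t - ε) t).indicator (fun s => volterraKer a b ψ α Q t s (B (u s))) s := by
      intro s hs
      have h0 : t - (b - a) ≤ s := by linarith [ht.2, hs.1]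
      rcases lt_or_ge s (t - ε) with h1 | h1
      · simp [indicator, h1, h0, not_le.2 h1, h1.trans (by linarith : t - ε < t)]
      · by_cases h2 : s < t <;> simp [indicator, h0, h1, h2, not_lt.2 h1]
    rw [truncVolterra_zero_eq B u ht, truncVolterra,
      setIntegral_congr_fun measurableSet_Icc hsplit, integral_sub hfull hslice, sub_sub_cancel]
  have hlim : Tendsto (fun ε : ℝ => E * √(ε ^ (2 * α - 1) / (2 * α - 1)) * ‖u‖) (𝓝[>] 0) (𝓝 0) := by
    have h1 : Continuous fun ε : ℝ => E * √(ε ^ (2 * α - 1) / (2 * α - 1)) * ‖u‖ := by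
      have := Real.continuous_rpow_const (show 0 ≤ 2 * α - 1 by linarith)
      fun_prop
    have h2 := h1.tendsto 0
    rw [Real.zero_rpow (by linarith), zero_div, Real.sqrt_zero, mul_zero, zero_mul] at h2
    exact h2.mono_left nhdsWithin_le_nhds
  have hunif : TendstoUniformlyOn (fun ε t => truncVolterra a b ψ α Q B u ε t)
      (truncVolterra a b ψ α Q B u 0) (𝓝[>] 0) (Icc a b) := by
    rw [Metric.tendstoUniformlyOn_iff]
    intro η hη
    filter_upwards [hlim.eventually_lt_const hη, self_mem_nhdsWithin] with ε h1 h2 t ht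
    rw [dist_eq_norm]
    exact (hdiff ε h2 t ht).trans_lt h1
  refine hunif.continuousOn (Eventually.frequently ?_)
  filter_upwards [self_mem_nhdsWithin] with ε hε
  exact continuousOn_truncVolterra hψ hα1 hQ B u hε

/-- The control-to-state map at the final time is a bounded linear map on `L²`. -/
theorem exists_clm_volterra (hab : a ≤ b) (hψ : IsTimeChange a b ψ c D) (hα : 1 / 2 < α)
    (hα1 : α ≤ 1) (hQ : ∀ x, Continuous fun t => Q t x) (B : Y →L[ℝ] X) :
    ∃ L : Control Y a b →L[ℝ] X, ∀ u, truncVolterra a b ψ α Q B u 0 b = L u := by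
  obtain ⟨E, hE0, hE⟩ := exists_norm_volterra_slice_le hψ hα hα1 hQ B
  have hb : b ∈ Icc a b := right_mem_Icc.2 hab
  have hba : 0 ≤ b - a := by linarith
  refine ⟨LinearMap.mkContinuous
    { toFun := fun u => truncVolterra a b ψ α Q B u 0 b
      map_add' := fun u v => ?_
      map_smul' := fun r u => ?_ } (E * √((b - a) ^ (2 * α - 1) / (2 * α - 1))) fun u => ?_,
    fun u => rfl⟩
  · rw [truncVolterra_zero_eq B _ hb, truncVolterra_zero_eq B _ hb, truncVolterra_zero_eq B _ hb,
      ← integral_add (hE u b hb _ hba).1 (hE v b hb _ hba).1]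
    refine integral_congr_ae ?_
    filter_upwards [Lp.coeFn_add u v] with s hs
    by_cases h : s ∈ Ico (b - (b - a)) b
    · simp only [indicator_of_mem h, hs, Pi.add_apply, volterraKer, map_add, smul_add]
    · simp only [indicator_of_notMem h, add_zero]
  · rw [truncVolterra_zero_eq B _ hb, truncVolterra_zero_eq B _ hb, RingHom.id_apply,
      ← integral_smul]
    refine integral_congr_ae ?_
    filter_upwards [Lp.coeFn_smul r u] with s hs
    by_cases h : s ∈ Ico (b - (b - a)) b
    · simp only [indicator_of_mem h, hs, Pi.smul_apply, volterraKer, map_smul, smul_comm r]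
    · simp only [indicator_of_notMem h, smul_zero]
  · change ‖truncVolterra a b ψ α Q B u 0 b‖ ≤ _
    rw [truncVolterra_zero_eq B _ hb]
    exact (hE u b hb _ hba).2

end volterra

end stateEquation

/-! ### Quadratic minimization in a Hilbert space -/

section minimization

variable {H X : Type*} [NormedAddCommGroup H] [InnerProductSpace ℝ H]
  [NormedAddCommGroup X] [NormedSpace ℝ X]

/-- Strong convexity: the parallelogram law in `H`, and plain convexity of the squared norm
of `X`, which need not come from an inner product. -/
theorem mul_norm_sub_sq_le (L : H →L[ℝ] X) (d : X) {lam : ℝ} (u v : H) :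
    lam / 4 * ‖u - v‖ ^ 2 ≤
      ((‖d + L u‖ ^ 2 + lam * ‖u‖ ^ 2) + (‖d + L v‖ ^ 2 + lam * ‖v‖ ^ 2)) / 2 -
      (‖d + L ((1 / 2 : ℝ) • (u + v))‖ ^ 2 + lam * ‖(1 / 2 : ℝ) • (u + v)‖ ^ 2) := by
  have h1 := parallelogram_law_with_norm ℝ u v
  have h2 : ‖d + L ((1 / 2 : ℝ) • (u + v))‖ ≤ (‖d + L u‖ + ‖d + L v‖) / 2 := by
    have : d + L ((1 / 2 : ℝ) • (u + v)) = (1 / 2 : ℝ) • ((d + L u) + (d + L v)) := by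
      rw [map_smul, map_add]
      module
    rw [this, norm_smul, Real.norm_of_nonneg (by norm_num)]
    linarith [norm_add_le (d + L u) (d + L v)]
  have h3 : ‖d + L ((1 / 2 : ℝ) • (u + v))‖ ^ 2 ≤ (‖d + L u‖ ^ 2 + ‖d + L v‖ ^ 2) / 2 := by
    have := pow_le_pow_left₀ (norm_nonneg _) h2 2
    nlinarith [sq_nonneg (‖d + L u‖ - ‖d + L v‖)]
  rw [norm_smul, Real.norm_of_nonneg (by norm_num : (0 : ℝ) ≤ 1 / 2)]
  linear_combination h3 + lam / 4 * h1

/-- Minimizing sequences of the regularized functional are Cauchy, by strong convexity. -/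
theorem existsUnique_minimizer [CompleteSpace H] (L : H →L[ℝ] X) (d : X) {lam : ℝ}
    (hlam : 0 < lam) :
    ∃! u : H, ∀ v : H, ‖d + L u‖ ^ 2 + lam * ‖u‖ ^ 2 ≤ ‖d + L v‖ ^ 2 + lam * ‖v‖ ^ 2 := by
  set J : H → ℝ := fun u => ‖d + L u‖ ^ 2 + lam * ‖u‖ ^ 2 with hJ
  have hkey : ∀ u v, lam / 4 * ‖u - v‖ ^ 2 ≤ (J u + J v) / 2 - J ((1 / 2 : ℝ) • (u + v)) :=
    fun u v => mul_norm_sub_sq_le L d u v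
  have hbdd : BddBelow (range J) := ⟨0, by rintro _ ⟨u, rfl⟩; positivity⟩
  have hm : ∀ u, ⨅ v, J v ≤ J u := fun u => ciInf_le hbdd u
  have hex : ∀ n : ℕ, ∃ u, J u < (⨅ v, J v) + 1 / ((n : ℝ) + 1) := fun n =>
    exists_lt_of_ciInf_lt (lt_add_of_pos_right _ (by positivity))
  choose w hw using hex
  have hcau : CauchySeq w := by
    refine cauchySeq_of_le_tendsto_0 (fun n : ℕ => √(4 / lam * (1 / ((n : ℝ) + 1)))) ?_ ?_
    · intro n k N hn hk
      rw [dist_eq_norm]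
      refine Real.le_sqrt_of_sq_le ?_
      have h1 : 1 / ((n : ℝ) + 1) ≤ 1 / ((N : ℝ) + 1) := by gcongr
      have h2 : 1 / ((k : ℝ) + 1) ≤ 1 / ((N : ℝ) + 1) := by gcongr
      have h3 := hkey (w n) (w k)
      have h4 := hm ((1 / 2 : ℝ) • (w n + w k))
      have h5 : lam / 4 * ‖w n - w k‖ ^ 2 ≤ 1 / ((N : ℝ) + 1) := by linarith [hw n, hw k]
      calc ‖w n - w k‖ ^ 2 = 4 / lam * (lam / 4 * ‖w n - w k‖ ^ 2) := by field_simp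
        _ ≤ _ := by gcongr
    · have := (Real.continuous_sqrt.tendsto _).comp
        ((tendsto_one_div_add_atTop_nhds_zero_nat (𝕜 := ℝ)).const_mul (4 / lam))
      simpa [Function.comp_def] using this
  obtain ⟨u, hu⟩ := cauchySeq_tendsto_of_complete hcau
  have hJc : Continuous J := by rw [hJ]; fun_prop
  have hmin : ∀ v, J u ≤ J v := by
    intro v
    refine le_trans ?_ (hm v)
    have h1 : Tendsto (fun n : ℕ => (⨅ v, J v) + 1 / ((n : ℝ) + 1)) atTop (𝓝 ((⨅ v, J v) + 0)) :=
      tendsto_one_div_add_atTop_nhds_zero_nat.const_add _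
    rw [add_zero] at h1
    exact le_of_tendsto_of_tendsto ((hJc.tendsto u).comp hu) h1
      (Eventually.of_forall fun n => (hw n).le)
  refine ⟨u, hmin, fun v hv => ?_⟩
  have h1 := hkey v u
  have h2 : J v ≤ J u := hv u
  have h3 := hmin ((1 / 2 : ℝ) • (v + u))
  have h4 : ‖v - u‖ ^ 2 ≤ 0 := by
    have : lam / 4 * ‖v - u‖ ^ 2 ≤ 0 := by linarith
    by_contra! h
    have := mul_pos (by positivity : 0 < lam / 4) h
    linarith
  exact sub_eq_zero.1 (norm_eq_zero.1 (pow_eq_zero_iff two_ne_zero |>.1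
    (le_antisymm h4 (sq_nonneg _))))

end minimization

/-! ### The contribution of the initial datum -/

variable {X Y : Type*} [NormedAddCommGroup X] [NormedSpace ℝ X]
  [NormedAddCommGroup Y] [InnerProductSpace ℝ Y]

/-- The rescaled fractional integral `Γ(μ)⁻¹ ∫₀¹ (1 - z)^(μ - 1) z^(α - 1) Q(τ z) x dz`,
read as `Q(τ) x` when `μ = 0`. -/
noncomputable def scaledS (α μ : ℝ) (Q : ℝ → X →L[ℝ] X) (x : X) (τ : ℝ) : X :=
  if μ = 0 then Q τ x
  else (Real.Gamma μ)⁻¹ • ∫ z in Ioo (0 : ℝ) 1, ((1 - z) ^ (μ - 1) * z ^ (α - 1)) • Q (τ * z) x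

theorem integrableOn_beta {α μ : ℝ} (hα : 0 < α) (hμ : 0 < μ) :
    IntegrableOn (fun z : ℝ => (1 - z) ^ (μ - 1) * z ^ (α - 1)) (Ioo 0 1) := by
  have h := (Complex.betaIntegral_convergent (u := α) (v := μ) (by simpa) (by simpa)).norm
  rw [intervalIntegrable_iff_integrableOn_Ioo_of_le zero_le_one] at h
  refine h.congr_fun (fun z hz => ?_) measurableSet_Ioo
  have h1 : (0 : ℝ) < 1 - z := by linarith [hz.2]
  have e1 : ((α : ℂ) - 1) = ((α - 1 : ℝ) : ℂ) := by push_cast; ring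
  have e2 : ((μ : ℂ) - 1) = ((μ - 1 : ℝ) : ℂ) := by push_cast; ring
  have e3 : (1 - (z : ℂ)) = ((1 - z : ℝ) : ℂ) := by push_cast; ring
  simp only
  rw [norm_mul, e1, e2, e3, Complex.norm_cpow_real, Complex.norm_cpow_real, Complex.norm_real,
    Complex.norm_real, Real.norm_of_nonneg hz.1.le, Real.norm_of_nonneg h1.le, mul_comm]

theorem continuousOn_scaledS [CompleteSpace X] {α μ : ℝ} (hα : 0 < α) (hμ : 0 ≤ μ)
    {Q : ℝ → X →L[ℝ] X} (hQ : ∀ x, Continuous fun t => Q t x) (x : X) (R : ℝ) :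
    ContinuousOn (scaledS α μ Q x) (Icc 0 R) := by
  unfold scaledS
  rcases hμ.eq_or_lt with rfl | hμ
  · simpa using (hQ x).continuousOn
  simp only [if_neg hμ.ne']
  refine ContinuousOn.const_smul ?_ _
  obtain ⟨C, hC0, hC⟩ := exists_norm_le_of_continuous hQ (isCompact_Icc (a := 0) (b := R))
  have hb := integrableOn_beta hα hμ
  refine continuousOn_of_dominated
    (bound := fun z => (1 - z) ^ (μ - 1) * z ^ (α - 1) * (C * ‖x‖)) ?_ ?_ (hb.mul_const _) ?_
  · intro τ _
    exact hb.aestronglyMeasurable.smul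
      ((hQ x).comp (continuous_const_mul τ)).aestronglyMeasurable
  · intro τ hτ
    filter_upwards [ae_restrict_mem measurableSet_Ioo] with z hz
    have h1 : (0 : ℝ) ≤ (1 - z) ^ (μ - 1) := Real.rpow_nonneg (by linarith [hz.2]) _
    have h2 : (0 : ℝ) ≤ z ^ (α - 1) := Real.rpow_nonneg hz.1.le _
    rw [norm_smul, Real.norm_of_nonneg (by positivity)]
    have hmem : τ * z ∈ Icc 0 R :=
      ⟨mul_nonneg hτ.1 hz.1.le, (mul_le_of_le_one_right hτ.1 hz.2.le).trans hτ.2⟩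
    gcongr
    exact (Q _).le_of_opNorm_le (hC _ hmem) x
  · refine Eventually.of_forall fun z => Continuous.continuousOn ?_
    exact ((hQ x).comp (continuous_mul_const z)).const_smul _

namespace IsTimeChange

variable {a b c D : ℝ} {ψ : ℝ → ℝ}

/-- Substituting `z = (ψ(s) - ψ(a)) / (ψ(t) - ψ(a))`. -/
theorem integral_comp (h : IsTimeChange a b ψ c D) {t : ℝ} (ht : t ∈ Ioc a b) (g : ℝ → X) :
    ∫ z in Ioo (0 : ℝ) 1, g z =
      ∫ s in Ioo a t, (dpsi a b ψ s / (ψ t - ψ a)) • g ((ψ s - ψ a) / (ψ t - ψ a)) := by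
  have hsub : Icc a t ⊆ Icc a b := Icc_subset_Icc_right ht.2
  have hmono := h.strictMonoOn.mono hsub
  have hta : a ∈ Icc a t := left_mem_Icc.2 ht.1.le
  have htt : t ∈ Icc a t := right_mem_Icc.2 ht.1.le
  have hτ : 0 < ψ t - ψ a := sub_pos.2 (hmono hta htt ht.1)
  have himg : (fun s => (ψ s - ψ a) / (ψ t - ψ a)) '' Ioo a t = Ioo 0 1 := by
    refine Subset.antisymm ?_ ?_
    · rintro _ ⟨s, hs, rfl⟩
      have hs' := Ioo_subset_Icc_self hs
      exact ⟨div_pos (sub_pos.2 (hmono hta hs' hs.1)) hτ,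
        (div_lt_one hτ).2 (sub_lt_sub_right (hmono hs' htt hs.2) _)⟩
    · have hc : ContinuousOn (fun s => (ψ s - ψ a) / (ψ t - ψ a)) (Icc a t) :=
        ((h.continuousOn.mono hsub).sub continuousOn_const).div_const _
      have := intermediate_value_Ioo ht.1.le hc
      simpa [div_self hτ.ne'] using this
  rw [← himg, integral_image_eq_integral_abs_deriv_smul (f' := fun s => dpsi a b ψ s / (ψ t - ψ a))
    measurableSet_Ioo]
  · refine setIntegral_congr_fun measurableSet_Ioo fun s hs => ?_
    have := h.dpsi_nonneg s (hsub (Ioo_subset_Icc_self hs))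
    rw [abs_of_nonneg (by positivity)]
  · intro s hs
    have := (h.hasDeriv s (hsub (Ioo_subset_Icc_self hs))).mono
      (Ioo_subset_Icc_self.trans hsub : Ioo a t ⊆ _)
    exact (this.sub_const _).div_const _
  · intro s hs s' hs' heq
    refine hmono.injOn (Ioo_subset_Icc_self hs) (Ioo_subset_Icc_self hs') ?_
    have := (div_left_inj' hτ.ne').1 heq
    linarith

/-- The weight `(ψ(t) - ψ(a))^(1 - γ)` exactly absorbs the singularity of `S_{α,β}` at `a`. -/
theorem rpow_smul_opS_eq (h : IsTimeChange a b ψ c D) {α β : ℝ} {T Q : ℝ → X →L[ℝ] X}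
    (hTQ : ∀ t, 0 ≤ t → ∀ x, opP α T t x = Q t x) {t : ℝ} (ht : t ∈ Ioc a b) (x : X) :
    (ψ t - ψ a) ^ (1 - gam α β) • opS a b ψ α β T t x =
      scaledS α (gam α β - α) Q x (ψ t - ψ a) := by
  have hab : a ≤ b := ht.1.le.trans ht.2
  have hmono := h.strictMonoOn
  have ha : a ∈ Icc a b := left_mem_Icc.2 hab
  have hτ : 0 < ψ t - ψ a := sub_pos.2 (hmono ha (Ioc_subset_Icc_self ht) ht.1)
  unfold opS fracIntegral scaledS
  by_cases hμ : gam α β - α = 0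
  · rw [if_pos hμ, if_pos hμ]
    beta_reduce
    rw [opK, hTQ _ hτ.le, smul_smul, ← Real.rpow_add hτ,
      show 1 - gam α β + (α - 1) = 0 by linarith, Real.rpow_zero, one_smul]
  rw [if_neg hμ, if_neg hμ, smul_comm]
  congr 1
  rw [h.integral_comp ht, intervalIntegral.integral_of_le ht.1.le, integral_Ioc_eq_integral_Ioo,
    ← integral_smul]
  refine setIntegral_congr_fun measurableSet_Ioo fun s hs => ?_
  have hs' : s ∈ Icc a b := ⟨hs.1.le, hs.2.le.trans ht.2⟩
  have h1 : 0 < ψ s - ψ a := sub_pos.2 (hmono ha hs' hs.1)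
  have h2 : 0 < ψ t - ψ s := sub_pos.2 (hmono hs' (Ioc_subset_Icc_self ht) hs.2)
  simp only
  rw [opK, hTQ _ h1.le, mul_div_cancel₀ _ hτ.ne', smul_smul, smul_smul, smul_smul]
  congr 1
  rw [one_sub_div hτ.ne', sub_sub_sub_cancel_right, Real.div_rpow h2.le hτ.le,
    Real.div_rpow h1.le hτ.le]
  have e : (ψ t - ψ a) ^ (1 - gam α β) *
      ((ψ t - ψ a) * (ψ t - ψ a) ^ (gam α β - α - 1) * (ψ t - ψ a) ^ (α - 1)) = 1 := by
    nth_rewrite 2 [← Real.rpow_one (ψ t - ψ a)]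
    rw [← Real.rpow_add hτ, ← Real.rpow_add hτ, ← Real.rpow_add hτ]
    ring_nf
    exact Real.rpow_zero _
  have p1 := Real.rpow_pos_of_pos hτ (gam α β - α - 1)
  have p2 := Real.rpow_pos_of_pos hτ (α - 1)
  rw [eq_inv_of_mul_eq_one_left e]
  field_simp

end IsTimeChange

/-! ### Mild solutions and the optimal pair -/

/-- The right-hand side of the mild solution formula. -/
noncomputable def mildFormula (a b : ℝ) (ψ : ℝ → ℝ) (α β : ℝ) (T : ℝ → X →L[ℝ] X)
    (B : Y →L[ℝ] X) (x₀ : X) (u : Control Y a b) (t : ℝ) : X :=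
  opS a b ψ α β T t x₀ + ∫ s in a..t, dpsi a b ψ s • opK α T (ψ t - ψ s) (B (u s))

theorem IsTimeChange.integral_opK_eq {a b c D α : ℝ} {ψ : ℝ → ℝ} (h : IsTimeChange a b ψ c D)
    {T Q : ℝ → X →L[ℝ] X} (hTQ : ∀ t, 0 ≤ t → ∀ x, opP α T t x = Q t x) (B : Y →L[ℝ] X)
    (u : Control Y a b) {t : ℝ} (ht : t ∈ Icc a b) :
    ∫ s in a..t, dpsi a b ψ s • opK α T (ψ t - ψ s) (B (u s)) =
      truncVolterra a b ψ α Q B u 0 t := by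
  rw [truncVolterra_zero_eq_intervalIntegral B u ht]
  refine intervalIntegral.integral_congr fun s hs => ?_
  rw [uIcc_of_le ht.1] at hs
  have h0 : 0 ≤ ψ t - ψ s :=
    sub_nonneg.2 (h.strictMonoOn.monotoneOn ⟨hs.1, hs.2.trans ht.2⟩ ht hs.2)
  rw [opK, hTQ _ h0, smul_smul, volterraKer]

/-- Every square integrable control has a mild solution in the weighted space. -/
theorem IsTimeChange.mildFormula_mem [CompleteSpace X] {a b c D α β : ℝ} {ψ : ℝ → ℝ}
    (h : IsTimeChange a b ψ c D) (hα : 1 / 2 < α) (hα1 : α ≤ 1) (hβ : 0 ≤ β) (hβ1 : β ≤ 1)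
    {T Q : ℝ → X →L[ℝ] X} (hTQ : ∀ t, 0 ≤ t → ∀ x, opP α T t x = Q t x)
    (hQ : ∀ x, Continuous fun t => Q t x) (B : Y →L[ℝ] X) (x₀ : X) (u : Control Y a b) :
    (fun t : Ioc a b => mildFormula a b ψ α β T B x₀ u t) ∈ WeightedC X a b ψ (gam α β) := by
  have hμ : 0 ≤ gam α β - α := by
    have := mul_nonneg hβ (sub_nonneg.2 hα1)
    unfold gam; linarith
  have hγ : 0 ≤ 1 - gam α β := by
    have := mul_nonneg (sub_nonneg.2 hβ1) (sub_nonneg.2 hα1)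
    unfold gam; linarith
  have hmono := h.strictMonoOn
  have hτc : ContinuousOn (fun t => ψ t - ψ a) (Icc a b) := h.continuousOn.sub continuousOn_const
  have hmaps : MapsTo (fun t => ψ t - ψ a) (Icc a b) (Icc 0 (ψ b - ψ a)) := fun t ht =>
    have hab := ht.1.trans ht.2
    ⟨sub_nonneg.2 (hmono.monotoneOn (left_mem_Icc.2 hab) ht ht.1),
      sub_le_sub_right (hmono.monotoneOn ht (right_mem_Icc.2 hab) ht.2) _⟩
  have hy : ContinuousOn (fun t => (ψ t - ψ a) ^ (1 - gam α β) • truncVolterra a b ψ α Q B u 0 t +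
      scaledS α (gam α β - α) Q x₀ (ψ t - ψ a)) (Icc a b) :=
    ((hτc.rpow_const fun _ _ => Or.inr hγ).smul (continuousOn_volterra h hα hα1 hQ B u)).add
      ((continuousOn_scaledS (by linarith) hμ hQ x₀ _).comp hτc hmaps)
  have heq : ∀ t ∈ Ioc a b, (ψ t - ψ a) ^ (1 - gam α β) • truncVolterra a b ψ α Q B u 0 t +
      scaledS α (gam α β - α) Q x₀ (ψ t - ψ a) =
      (ψ t - ψ a) ^ (1 - gam α β) • mildFormula a b ψ α β T B x₀ u t := by
    intro t ht
    rw [mildFormula, h.integral_opK_eq hTQ B u (Ioc_subset_Icc_self ht), smul_add,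
      h.rpow_smul_opS_eq hTQ ht, add_comm]
  -- continuity of `q` on `(a, b]` follows from that of the weighted function, divided by the weight
  refine ⟨?_, ⟨⟨_, hy.domRestrict⟩, fun t => heq t t.2⟩⟩
  have hpos : ∀ t ∈ Ioc a b, 0 < ψ t - ψ a := fun t ht =>
    sub_pos.2 (hmono (left_mem_Icc.2 (ht.1.le.trans ht.2)) (Ioc_subset_Icc_self ht) ht.1)
  have hq : ContinuousOn (mildFormula a b ψ α β T B x₀ u) (Ioc a b) := by
    refine (((hτc.mono Ioc_subset_Icc_self).rpow_const
      (p := -(1 - gam α β)) fun t ht => Or.inl (hpos t ht).ne').smul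
      (hy.mono Ioc_subset_Icc_self)).congr fun t ht => ?_
    rw [Pi.smul_apply', heq t ht, smul_smul, ← Real.rpow_add (hpos t ht), neg_add_cancel,
      Real.rpow_zero, one_smul]
  exact hq.domRestrict

end PsiHilfer

theorem mainTheorem3 {X Y : Type*}
    [NormedAddCommGroup X] [NormedSpace ℝ X] [CompleteSpace X]
    [NormedAddCommGroup Y] [InnerProductSpace ℝ Y] [CompleteSpace Y]
    [TopologicalSpace.SeparableSpace Y]
    (a b : ℝ) (hab : a < b)
    (ψ : ℝ → ℝ) (hψ : ContDiffOn ℝ 1 ψ (Set.Icc a b)) (hψmono : MonotoneOn ψ (Set.Icc a b))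
    (hψ' : ∀ t ∈ Set.Icc a b, derivWithin ψ (Set.Icc a b) t ≠ 0)
    (α β : ℝ) (hα : 1 / 2 < α) (hα1 : α ≤ 1) (hβ : 0 ≤ β) (hβ1 : β ≤ 1)
    (A : X →ₗ.[ℝ] X) (T : ℝ → X →L[ℝ] X) (hT : PsiHilfer.IsC0Semigroup T)
    (hA : PsiHilfer.IsGenerator A T)
    (B : Y →L[ℝ] X) (x₀ xb : X) (lam : ℝ) (hlam : 0 < lam) :
    ∃! p : PsiHilfer.WeightedC X a b ψ (PsiHilfer.gam α β) × PsiHilfer.Control Y a b,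
      p ∈ PsiHilfer.admissible a b ψ α β T B x₀ ∧
      IsMinOn (PsiHilfer.cost hab ψ (PsiHilfer.gam α β) xb lam)
        (PsiHilfer.admissible a b ψ α β T B x₀) p := by
  open PsiHilfer in
  obtain ⟨c, D, hc⟩ := exists_isTimeChange hab hψ hψmono hψ'
  obtain ⟨Q, hQ, hTQ⟩ := exists_clm_opP hT (by linarith : 0 < α) hα1
  obtain ⟨L, hL⟩ := exists_clm_volterra hab.le hc hα hα1 hQ B
  set d : X := opS a b ψ α β T b x₀ - xb with hd
  set sol : Control Y a b → WeightedC X a b ψ (gam α β) × Control Y a b := fun u =>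
    (⟨_, hc.mildFormula_mem hα hα1 hβ hβ1 hTQ hQ B x₀ u⟩, u) with hsol
  have hadm : ∀ u, sol u ∈ admissible a b ψ α β T B x₀ := fun u t => rfl
  have huniq : ∀ p ∈ admissible a b ψ α β T B x₀, p = sol p.2 := fun p hp =>
    Prod.ext (Subtype.ext (funext fun t => hp t)) rfl
  have hcost : ∀ u, cost hab ψ (gam α β) xb lam (sol u) = ‖d + L u‖ ^ 2 + lam * ‖u‖ ^ 2 := by
    intro u
    have hb : b ∈ Icc a b := right_mem_Icc.2 hab.le
    have h1 : mildFormula a b ψ α β T B x₀ u b - xb = d + L u := by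
      rw [mildFormula, hc.integral_opK_eq hTQ B u hb, hL, hd]
      abel
    have h2 : ∫ t in a..b, ‖u t‖ ^ 2 = ‖u‖ ^ 2 := by
      rw [intervalIntegral.integral_of_le hab.le, ← integral_Icc_eq_integral_Ioc,
        Control.integral_norm_sq]
    rw [← h1, ← h2]
    rfl
  obtain ⟨u, hu, huu⟩ := existsUnique_minimizer L d hlam
  refine ⟨sol u, ⟨hadm u, fun p hp => ?_⟩, fun p ⟨hp, hmin⟩ => ?_⟩
  · rw [mem_ofPred_eq, huniq p hp, hcost, hcost]
    exact hu p.2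
  · rw [huniq p hp]
    congr 1
    refine huu p.2 fun v => ?_
    have := hmin (hadm v)
    rwa [mem_ofPred_eq, huniq p hp, hcost, hcost] at this
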